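/- Fix an integer $k \ge 1$. For a prime $p > 2$ with $p > k$, let $\chi$ be the quadratic character (Legendre symbol) of $\mathbb{F}_p$, and let $\Delta_{p-1}$ be the $(p-1)$-simplex on the vertex set $\mathbb{F}_p$, so that its $j$-dimensional faces are the $(j+1)$-element subsets of $\mathbb{F}_p$. Let $C^j(\Delta_{p-1})$ be the space of $\mathbb{Z}/2$-valued functions on the $j$-dimensional faces, with coboundary map $d_{k-1}\colon C^{k-1}(\Delta_{p-1}) \to C^k(\Delta_{p-1})$ given by $(d_{k-1}\psi)(\sigma) = \sum_{v\in\sigma} \psi(\sigma\setminus\{v\})$. For $\phi\in C^k(\Delta_{p-1})$ let $\|\phi\|$ be the number of $k$-dimensional faces on which $\phi$ is nonzero, and let $$\|\phi\|_{csy} = \min_{\psi\in C^{k-1}(\Delta_{p-1})} \|\phi + d_{k-1}\psi\|$$ be its cosystolic norm. Let the Paley $k$-cochain $\phi_k\in C^k(\Delta_{p-1})$ be defined by $\phi_k(\{x_0,\dots,x_k\}) = 1$ if $\chi(x_0+\dots+x_k)=1$, and $\phi_k(\{x_0,\dots,x_k\})=0$ otherwise. Then there is a constant $C = C(k)$, depending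 only on $k$, such that for every prime $p>2$ with $p>k$, $$\|\phi_k\|_{csy} \;\ge\; \frac12 \binom{p}{k+1}\left(1 - C\,p^{-2^{-k}}\right).$$ -/

import Mathlib

namespace SimplexCochain

/-- The faces with `n` vertices (that is, of dimension `n - 1`) of the simplex on the vertex
set `V`. -/
abbrev Face (V : Type*) (n : ℕ) : Type _ := {σ : Finset V // σ.card = n}

/-- Cochains with `ℤ/2` coefficients on the faces with `n` vertices. For the simplex `Δ` on the
vertex set `V`, the space of `k`-cochains `C^k(Δ)` is `Cochain V (k + 1)`. -/
abbrev Cochain (V : Type*) (n : ℕ) : Type _ := Face V n → ZMod 2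

/-- The facet of `σ` opposite to the vertex `v`. -/
def Face.erase {V : Type*} [DecidableEq V] {n : ℕ} (σ : Face V (n + 1)) (v : V)
    (hv : v ∈ σ.1) : Face V n :=
  ⟨σ.1.erase v, by rw [Finset.card_erase_of_mem hv, σ.2, Nat.add_sub_cancel]⟩

/-- The coboundary `C^{k-1} → C^k` (with `n = k`): its value at a `k`-face is the sum of the
values at the `(k-1)`-dimensional facets. -/
def coboundary {V : Type*} [DecidableEq V] {n : ℕ} (ψ : Cochain V n) : Cochain V (n + 1) :=
  fun σ => ∑ v ∈ σ.1.attach, ψ (σ.erase v.1 v.2)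

/-- The norm of a cochain: the size of its support. -/
def norm {V : Type*} [Fintype V] [DecidableEq V] {n : ℕ} (φ : Cochain V n) : ℕ :=
  (Finset.univ.filter fun σ : Face V n => φ σ ≠ 0).card

/-- The cosystolic norm of a `k`-cochain (with `n = k`): the minimum of `‖φ + dψ‖` over all
`(k-1)`-cochains `ψ`. -/
noncomputable def cosystolicNorm {V : Type*} [Fintype V] [DecidableEq V] {n : ℕ}
    (φ : Cochain V (n + 1)) : ℕ :=
  ⨅ ψ : Cochain V n, norm (φ + coboundary ψ)

/-- The Paley `k`-cochain on the `(p-1)`-simplex with vertex set `𝔽_p`: it is `1` on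
`{x₀, …, x_k}` if `χ(x₀ + ⋯ + x_k) = 1` for the quadratic character `χ`, and `0` otherwise. -/
def paley (p : ℕ) [Fact p.Prime] (k : ℕ) : Cochain (ZMod p) (k + 1) :=
  fun σ => if quadraticChar (ZMod p) (∑ x ∈ σ.1, x) = 1 then 1 else 0

end SimplexCochain

/-! Twice the norm of a cochain is the number of faces minus the sum of its signs, so one must show
that the signs of `paley + coboundary ψ` nearly cancel, uniformly in `ψ`. Over ordered tuples of `k
+ 1` vertices, the sign of the Paley cochain is `-χ(∑ xᵢ)` up to the tuples with zero sum, and the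
sign of a coboundary is a product of bounded functions, each missing one variable. Repeated vertices
and zero sums cost only `O(p ^ k)` tuples. It remains to see that `χ(∑ xᵢ)` does not correlate with
such products (`exists_abs_multilinear_sum_le`).

Each Cauchy–Schwarz step removes one function and one variable, doubles the number of shifted
characters in the kernel and halves the saved exponent (`sq_multilinear_sum_le`). Two variables
leave a bilinear form with kernel `g (x + y)`, governed by the Fourier transform of `g`, a product
of `m` shifted quadratic characters. Its bound `m √p` saves `p ^ (1/2)`, and the remaining halvings
bring the saving down to `p ^ (2 ^ (-k))`.

The Fourier bound is a case of Weil's theorem, proved here from scratch. The hybrid sum is the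
linear coefficient of an L-function of `𝔽_p[X]` which is a polynomial of degree at most `m`, so its
analogues over extensions are minus power sums of `m` numbers `ω`. Summed over all additive twists,
additive Hilbert 90 turns these analogues into pure quadratic character sums of a squarefree
polynomial of degree `m p`. Stepanov's method bounds those over fields of order `p ^ (2 n)` by `O(p
^ n)`. As `n` varies, this forces `‖ω‖ ≤ √p` for every twist at once. -/

open Polynomial

/-! ### Stepanov's method: nonvanishing of the auxiliary polynomial -/

section Stepanov

variable {K : Type*} [Field K]

/-- Compare multiplicities at an irreducible factor of `F`: odd on the left, even on the right. -/
theorem Polynomial.eq_zero_of_squarefree_mul_sq_eq {F a b : K[X]} (hF : Squarefree F)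
    (hdeg : 0 < F.natDegree) {c : K} (hc : c ≠ 0) (h : F * a ^ 2 = C c * b ^ 2) : a = 0 := by
  by_contra ha
  have hF0 : F ≠ 0 := hF.ne_zero
  have hb : b ≠ 0 := by
    rintro rfl
    simp [ha, hF0] at h
  obtain ⟨P, hP, hPF⟩ := exists_irreducible_of_natDegree_pos hdeg
  have hPp : Prime P := hP.prime
  have fm : ∀ {g : K[X]}, g ≠ 0 → FiniteMultiplicity P g := fun hg =>
    FiniteMultiplicity.of_prime_left hPp hg
  have e1 : emultiplicity P F = 1 := by
    refine le_antisymm ?_ ?_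
    · rcases (squarefree_iff_emultiplicity_le_one F).1 hF P with h | h
      · exact h
      · exact absurd h hP.not_isUnit
    · exact le_emultiplicity_of_pow_dvd (by simpa using hPF)
  have ec : emultiplicity P (C c) = 0 := by
    rw [emultiplicity_eq_zero]
    intro hd
    exact hP.not_isUnit (isUnit_of_dvd_unit hd (isUnit_C.2 hc.isUnit))
  have := congrArg (emultiplicity P) h
  rw [emultiplicity_mul hPp, emultiplicity_mul hPp, emultiplicity_pow hPp, emultiplicity_pow hPp,
    e1, ec, (fm ha).emultiplicity_eq_multiplicity, (fm hb).emultiplicity_eq_multiplicity] at this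
  have h2 : 1 + 2 * multiplicity P a = 2 * multiplicity P b := by
    have h3 : ((1 + 2 * multiplicity P a : ℕ) : ℕ∞) = ((2 * multiplicity P b : ℕ) : ℕ∞) := by
      push_cast
      simpa using this
    exact_mod_cast h3
  omega

theorem Polynomial.X_pow_dvd_pow_sub_C {p : ℕ} [Fact p.Prime] [CharP K p] (F : K[X]) (μ : ℕ) :
    X ^ p ^ μ ∣ F ^ p ^ μ - C (F.eval 0 ^ p ^ μ) := by
  rw [C_pow, ← sub_pow_char_pow]
  refine pow_dvd_pow_of_dvd ?_ _
  rw [X_dvd_iff, coeff_zero_eq_eval_zero]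
  simp

/-- The auxiliary polynomials of the Stepanov method are linearly independent. -/
theorem Polynomial.stepanov_independent {p : ℕ} [Fact p.Prime] [CharP K p] {F : K[X]}
    (hF : Squarefree F) (hdeg : 0 < F.natDegree) (hF0 : F.eval 0 ≠ 0) {μ ρ A : ℕ}
    (hr : p ^ μ = 2 * ρ + 1) (hA : F.natDegree + 2 * A ≤ p ^ μ) (B : ℕ) :
    ∀ (a b : ℕ → K[X]), (∀ i, (a i).degree < A) → (∀ i, (b i).degree < A) →
      ∑ i ∈ Finset.range B, (a i + b i * F ^ ρ) * X ^ (i * p ^ μ) = 0 →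
      ∀ i < B, a i = 0 ∧ b i = 0 := by
  have hr0 : 0 < p ^ μ := by omega
  induction B with
  | zero => intro a b _ _ _ i hi; omega
  | succ B ih =>
    intro a b ha hb h
    rw [Finset.sum_range_succ'] at h
    set G : K[X] := ∑ i ∈ Finset.range B, (a (i + 1) + b (i + 1) * F ^ ρ) * X ^ (i * p ^ μ)
      with hG
    have hS : ∑ i ∈ Finset.range B, (a (i + 1) + b (i + 1) * F ^ ρ) * X ^ ((i + 1) * p ^ μ)
        = X ^ p ^ μ * G := by
      rw [hG, Finset.mul_sum]
      refine Finset.sum_congr rfl fun i _ => ?_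
      ring
    rw [hS] at h
    simp only [zero_mul, pow_zero, mul_one] at h
    have hc : F.eval 0 ^ p ^ μ ≠ 0 := pow_ne_zero _ hF0
    -- Modulo `X ^ r`, with `r = p ^ μ`, the relation reads `a 0 = -b 0 * F ^ ρ`. Squaring and
    -- multiplying by `F` produces `F ^ (2 * ρ + 1) = F ^ r`, which is congruent to a constant. The
    -- degree of the resulting expression is below `r`, so it vanishes identically.
    have hdvd : X ^ p ^ μ ∣ F * a 0 ^ 2 - C (F.eval 0 ^ p ^ μ) * b 0 ^ 2 := by
      have e : F * a 0 ^ 2 - C (F.eval 0 ^ p ^ μ) * b 0 ^ 2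
          = (F ^ p ^ μ - C (F.eval 0 ^ p ^ μ)) * b 0 ^ 2
            + X ^ p ^ μ * (F * (b 0 * F ^ ρ - a 0) * G) := by
        have h1 : a 0 + b 0 * F ^ ρ = - (X ^ p ^ μ * G) := by linear_combination h
        have h2 : F ^ p ^ μ = F * (F ^ ρ) ^ 2 := by rw [hr]; ring
        rw [h2]
        linear_combination (F * (a 0 - b 0 * F ^ ρ)) * h1
      rw [e]
      exact dvd_add (dvd_mul_of_dvd_left (X_pow_dvd_pow_sub_C F μ) _) (dvd_mul_right _ _)
    have hzero : F * a 0 ^ 2 - C (F.eval 0 ^ p ^ μ) * b 0 ^ 2 = 0 := by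
      by_contra hne
      have hle := natDegree_le_of_dvd hdvd hne
      rw [natDegree_X_pow] at hle
      have nd : ∀ g : K[X], g.degree < A → g.natDegree + 1 ≤ A ∨ g = 0 := by
        intro g hg
        by_cases h0 : g = 0
        · exact Or.inr h0
        · exact Or.inl ((natDegree_lt_iff_degree_lt h0).2 hg)
      have hlt : (F * a 0 ^ 2 - C (F.eval 0 ^ p ^ μ) * b 0 ^ 2).natDegree < p ^ μ := by
        refine lt_of_le_of_lt (natDegree_sub_le _ _) (max_lt ?_ ?_)
        · rcases nd _ (ha 0) with h | h
          · have := natDegree_mul_le (p := F) (q := a 0 ^ 2)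
            have h3 := natDegree_pow_le (p := a 0) (n := 2)
            omega
          · simpa [h] using hr0
        · rcases nd _ (hb 0) with h | h
          · have := natDegree_C_mul_le (F.eval 0 ^ p ^ μ) (b 0 ^ 2)
            have h3 := natDegree_pow_le (p := b 0) (n := 2)
            omega
          · simpa [h] using hr0
      omega
    have ha0 : a 0 = 0 := eq_zero_of_squarefree_mul_sq_eq hF hdeg hc (sub_eq_zero.1 hzero)
    have hb0 : b 0 = 0 := by
      rw [ha0] at hzero
      simpa [hF0, hr0.ne'] using hzero
    rw [ha0, hb0] at h
    have hG0 : G = 0 := by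
      simpa using h
    have := ih (fun i => a (i + 1)) (fun i => b (i + 1)) (fun i => ha _) (fun i => hb _) hG0
    intro i hi
    rcases i with _ | i
    · exact ⟨ha0, hb0⟩
    · exact this i (by omega)

end Stepanov

/-! ### Stepanov's method: construction, root count, and the quadratic Weil bound -/

section StepanovCount

variable {K : Type*} [Field K] [Fintype K] [DecidableEq K]

/-- Siegel-type pigeonhole: the constraint imposed on the auxiliary polynomials has a nontrivial
solution as soon as there are more unknown coefficients than equations. -/
theorem Polynomial.stepanov_exists {p : ℕ} [Fact p.Prime] [CharP K p] (F : K[X]) (ε : K)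
    {μ ρ A B : ℕ} (hA : 0 < A)
    (hT : p ^ μ * A + F.natDegree * ρ + B < 2 * A * B) :
    ∃ a b : ℕ → K[X], (∀ i, (a i).degree < A) ∧ (∀ i, (b i).degree < A) ∧
      (∃ i < B, a i ≠ 0 ∨ b i ≠ 0) ∧
      ∑ i ∈ Finset.range B, (a i ^ p ^ μ * F ^ ρ + C ε * b i ^ p ^ μ) * X ^ i = 0 := by
  classical
  set r := p ^ μ with hr
  set T := r * A + F.natDegree * ρ + B with hTdef
  let V := Fin B → (Fin A → K) × (Fin A → K)
  let dec : (Fin A → K) → K[X] := fun v => ((degreeLTEquiv K A).symm v : K[X])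
  have dec_deg : ∀ v, (dec v).degree < A := fun v =>
    mem_degreeLT.1 ((degreeLTEquiv K A).symm v).2
  have dec_sub : ∀ v w, dec (v - w) = dec v - dec w := fun v w => by simp [dec]
  have dec_zero : ∀ v, dec v = 0 → v = 0 := fun v hv => by simpa [dec] using hv
  let Φ : V → K[X] := fun v =>
    ∑ i : Fin B, (dec (v i).1 ^ r * F ^ ρ + C ε * dec (v i).2 ^ r) * X ^ (i : ℕ)
  have hΦsub : ∀ v w, Φ (v - w) = Φ v - Φ w := by
    intro v w
    simp only [Φ, ← Finset.sum_sub_distrib]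
    refine Finset.sum_congr rfl fun i _ => ?_
    have h1 : dec ((v - w) i).1 = dec (v i).1 - dec (w i).1 := dec_sub _ _
    have h2 : dec ((v - w) i).2 = dec (v i).2 - dec (w i).2 := dec_sub _ _
    rw [h1, h2, hr, sub_pow_char_pow, sub_pow_char_pow]
    ring
  have natdec : ∀ v, (dec v).natDegree ≤ A - 1 := by
    intro v
    by_cases h0 : dec v = 0
    · simp [h0]
    · have := (natDegree_lt_iff_degree_lt h0).2 (dec_deg v)
      omega
  have hrA : r * (A - 1) ≤ r * A := Nat.mul_le_mul_left _ (by omega)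
  have hΦdeg : ∀ v, Φ v ∈ degreeLT K T := by
    intro v
    refine Submodule.sum_mem _ fun i _ => ?_
    rw [mem_degreeLT]
    refine lt_of_le_of_lt degree_le_natDegree ?_
    rw [Nat.cast_lt]
    have h1 : (dec (v i).1 ^ r * F ^ ρ).natDegree ≤ r * A + F.natDegree * ρ := by
      refine natDegree_mul_le.trans (add_le_add ?_ ?_)
      · exact natDegree_pow_le.trans ((Nat.mul_le_mul_left _ (natdec _)).trans hrA)
      · exact natDegree_pow_le.trans (by rw [mul_comm])
    have h2 : (C ε * dec (v i).2 ^ r).natDegree ≤ r * A + F.natDegree * ρ := by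
      refine (natDegree_C_mul_le _ _).trans (natDegree_pow_le.trans ?_)
      exact ((Nat.mul_le_mul_left _ (natdec _)).trans hrA).trans (Nat.le_add_right _ _)
    have h3 := natDegree_mul_le (p := dec (v i).1 ^ r * F ^ ρ + C ε * dec (v i).2 ^ r)
      (q := (X : K[X]) ^ (i : ℕ))
    have h4 := natDegree_add_le (dec (v i).1 ^ r * F ^ ρ) (C ε * dec (v i).2 ^ r)
    have h5 := max_le h1 h2
    rw [natDegree_X_pow] at h3
    have := i.2
    omega
  let Ψ : V → (Fin T → K) := fun v => degreeLTEquiv K T ⟨Φ v, hΦdeg v⟩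
  -- `Φ` involves `r`-th powers, so it is additive but not `K`-linear. Cardinalities are compared
  -- instead of dimensions, and the difference of two colliding vectors is the solution.
  have hcard : Fintype.card (Fin T → K) < Fintype.card V := by
    have hK := Fintype.one_lt_card (α := K)
    simp only [V, Fintype.card_fun, Fintype.card_fin, Fintype.card_prod, ← pow_add, ← pow_mul]
    refine Nat.pow_lt_pow_right hK ?_
    calc T < 2 * A * B := hT
      _ = (A + A) * B := by ring
  obtain ⟨v, w, hvw, hE⟩ := Fintype.exists_ne_map_eq_of_card_lt Ψ hcard
  have hΦeq : Φ (v - w) = 0 := by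
    rw [hΦsub, sub_eq_zero]
    simpa [Ψ] using hE
  obtain ⟨i, hi⟩ : ∃ i, (v - w) i ≠ 0 := Function.ne_iff.1 (sub_ne_zero.2 hvw)
  refine ⟨fun i => if h : i < B then dec ((v - w) ⟨i, h⟩).1 else 0,
    fun i => if h : i < B then dec ((v - w) ⟨i, h⟩).2 else 0, ?_, ?_, ⟨i, i.2, ?_⟩, ?_⟩
  · intro i
    dsimp only
    split_ifs
    · exact dec_deg _
    · rw [degree_zero]; exact WithBot.bot_lt_coe A
  · intro i
    dsimp only
    split_ifs
    · exact dec_deg _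
    · rw [degree_zero]; exact WithBot.bot_lt_coe A
  · simp only [i.2, dif_pos]
    by_contra! hcon
    exact hi (Prod.ext (dec_zero _ hcon.1) (dec_zero _ hcon.2))
  · rw [Finset.sum_range, ← hΦeq]
    refine Finset.sum_congr rfl fun i _ => ?_
    simp

/-- The points counted are roots of a nonzero auxiliary polynomial of degree `r ^ 2 / 2 + O(D * r)`.
Since the field has order `r ^ 2`, simple vanishing suffices and no derivatives are needed. -/
theorem Polynomial.card_filter_eval_pow_eq_le {p : ℕ} [Fact p.Prime] [CharP K p] {F : K[X]}
    (hF : Squarefree F) (hdeg : 0 < F.natDegree) (hF0 : F.eval 0 ≠ 0) {μ ρ : ℕ}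
    (hr : p ^ μ = 2 * ρ + 1) (hcard : Fintype.card K = (p ^ μ) ^ 2)
    (hbig : 2 * (F.natDegree + 2) ≤ p ^ μ) {ε : K} (hε : ε ≠ 0) :
    2 * (Finset.univ.filter fun x : K => F.eval x ^ (ρ * (p ^ μ + 1)) = ε).card
      ≤ (p ^ μ) ^ 2 + (8 * F.natDegree + 10) * p ^ μ := by
  set r := p ^ μ with hrdef
  set D := F.natDegree with hD
  -- `A` is the largest value that independence allows. `B` is half of `r` plus a multiple of `D`,
  -- just enough to have more unknowns than equations while keeping the degree, about `B * r`, near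
  -- `r ^ 2 / 2`.
  set A := (r - D) / 2 with hAdef
  set B := (ρ + 1) + (3 * D + 3) with hBdef
  have hA1 : D + 2 * A ≤ r := by omega
  have hA2 : r ≤ D + 2 * A + 1 := by omega
  have hA0 : 0 < A := by omega
  have hT : r * A + D * ρ + B < 2 * A * B := by
    have h1 : r * A + D * ρ + B < (r - D - 1) * B := by
      obtain ⟨t, ht⟩ : ∃ t, r = D + 2 + t := ⟨r - D - 2, by omega⟩
      have ht2 : r - D - 1 = t + 1 := by omega
      rw [ht2]
      have h3 : 2 * A ≤ r := by omega
      have h4 : 2 * ρ + 1 = D + 2 + t := by omega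
      have h5 : 2 * B = D + 2 + t + 1 + 2 * (3 * D + 3) := by omega
      have h6 : 2 * A ≤ t + 2 := by omega
      have h7 : D + 2 ≤ t := by omega
      nlinarith [Nat.mul_le_mul_left r h6, Nat.mul_le_mul_left D h7]
    refine h1.trans_le (Nat.mul_le_mul_right _ (by omega))
  obtain ⟨a, b, ha, hb, ⟨i₀, hi₀, hne⟩, hsum⟩ :=
    stepanov_exists (p := p) F ε (μ := μ) (ρ := ρ) hA0 hT
  set k : K[X] := ∑ i ∈ Finset.range B, (a i + b i * F ^ ρ) * X ^ (i * r) with hk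
  have hk0 : k ≠ 0 := by
    intro h
    have := stepanov_independent (p := p) hF hdeg hF0 hr hA1 B a b ha hb h i₀ hi₀
    rcases hne with h' | h'
    · exact h' this.1
    · exact h' this.2
  -- Raising `k(x)` to the power `r` replaces `x ^ (i * r)` by `x ^ i`, because `x ^ (r ^ 2) = x`.
  -- Multiplying by `w = F(x) ^ ρ`, with `w ^ (r + 1) = ε`, then gives the value at `x` of the
  -- constraint polynomial, which is zero.
  have hvan : ∀ x : K, F.eval x ^ (ρ * (r + 1)) = ε → k.IsRoot x := by
    intro x hx
    have hxq : x ^ (r * r) = x := by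
      rw [← sq, ← hcard]
      exact FiniteField.pow_card x
    set w := F.eval x ^ ρ with hw
    have hwε : w ^ r * w = ε := by
      rw [← hx, hw]
      ring
    have hw0 : w ≠ 0 := by
      intro h
      apply hε
      rw [← hwε, h, mul_zero]
    have e1 : k.eval x ^ r = ∑ i ∈ Finset.range B,
        ((a i).eval x ^ r + (b i).eval x ^ r * w ^ r) * x ^ i := by
      rw [hk, eval_finsetSum, hrdef, sum_pow_char_pow]
      refine Finset.sum_congr rfl fun i _ => ?_
      rw [← hrdef]
      simp only [eval_mul, eval_add, eval_pow, eval_X]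
      rw [mul_pow, ← hw, ← pow_mul, mul_assoc i, mul_comm i, pow_mul x (r * r), hxq, hrdef,
        add_pow_char_pow, mul_pow]
    have e2 : k.eval x ^ r * w = 0 := by
      have := congrArg (eval x) hsum
      simp only [eval_finsetSum, eval_mul, eval_add, eval_pow, eval_X, eval_C, eval_zero] at this
      rw [e1, Finset.sum_mul, ← this]
      refine Finset.sum_congr rfl fun i _ => ?_
      rw [← hwε, ← hw]
      ring
    rcases mul_eq_zero.1 e2 with h | h
    · exact pow_eq_zero_iff (by omega : r ≠ 0) |>.1 h
    · exact absurd h hw0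
  have hcount : (Finset.univ.filter fun x : K => F.eval x ^ (ρ * (r + 1)) = ε).card
      ≤ k.natDegree := by
    refine card_le_degree_of_subset_roots ?_
    intro x hx
    rw [mem_roots hk0]
    exact hvan x (by simpa using hx)
  have hkdeg : k.natDegree ≤ A + D * ρ + (B - 1) * r := by
    refine natDegree_sum_le_of_forall_le _ _ fun i hi => ?_
    have hiB : i ≤ B - 1 := by have := Finset.mem_range.1 hi; omega
    have nd : ∀ g : K[X], g.degree < A → g.natDegree ≤ A := fun g hg =>
      natDegree_le_of_degree_le hg.le
    have h1 : (b i * F ^ ρ).natDegree ≤ A + D * ρ :=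
      natDegree_mul_le.trans (add_le_add (nd _ (hb i))
        (natDegree_pow_le.trans (by rw [mul_comm])))
    have h2 : (a i).natDegree ≤ A + D * ρ := (nd _ (ha i)).trans (Nat.le_add_right _ _)
    refine natDegree_mul_le.trans (add_le_add ?_ ?_)
    · exact (natDegree_add_le _ _).trans (max_le h2 h1)
    · rw [natDegree_X_pow]
      exact Nat.mul_le_mul_right _ hiB
  have hB1 : B - 1 = ρ + (3 * D + 3) := by omega
  rw [hB1] at hkdeg
  nlinarith [hcount, hkdeg, hA1, hr]

/-- Weil's bound for quadratic character sums over fields of square order. -/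
theorem Polynomial.abs_sum_quadraticChar_eval_le {p : ℕ} [Fact p.Prime] [CharP K p] (hp : p ≠ 2)
    {F : K[X]} (hF : Squarefree F) (hdeg : 0 < F.natDegree) {μ : ℕ}
    (hcard : Fintype.card K = (p ^ μ) ^ 2) :
    |∑ x : K, quadraticChar K (F.eval x)| ≤ (9 * F.natDegree + 10) * p ^ μ := by
  have hchar : ringChar K ≠ 2 := by rwa [ringChar.eq K p]
  have hpr : 0 < p ^ μ := pow_pos (Fact.out : p.Prime).pos _
  have key : ∀ G : K[X], Squarefree G → G.natDegree = F.natDegree → G.eval 0 ≠ 0 →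
      |∑ x : K, quadraticChar K (G.eval x)| ≤ (9 * F.natDegree + 10) * p ^ μ := by
    intro G hG hGd hG0
    obtain ⟨ρ, hρ⟩ : ∃ ρ, p ^ μ = 2 * ρ + 1 :=
      ((Fact.out : p.Prime).odd_of_ne_two hp).pow
    have triv : |∑ x : K, quadraticChar K (G.eval x)| ≤ (Fintype.card K : ℤ) := by
      refine (Finset.abs_sum_le_sum_abs _ _).trans ?_
      have : ∀ x ∈ (Finset.univ : Finset K), |quadraticChar K (G.eval x)| ≤ 1 := by
        intro x _
        by_cases h : G.eval x = 0
        · simp [h]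
        · rcases quadraticChar_dichotomy h with h | h <;> simp [h]
      simpa using Finset.sum_le_card_nsmul _ _ _ this
    -- For large `r`, upper bounds for both values `±1` suffice: the two counts add up to `r ^ 2`
    -- minus at most `deg G`, so each is also bounded below. For small `r` the trivial bound `r ^ 2`
    -- is enough.
    by_cases hbig : 2 * (G.natDegree + 2) ≤ p ^ μ
    · have hexp : Fintype.card K / 2 = ρ * (p ^ μ + 1) := by
        rw [hcard, hρ]
        have : (2 * ρ + 1) ^ 2 = 2 * (ρ * (2 * ρ + 1 + 1)) + 1 := by ring
        omega
      have chi : ∀ x, (quadraticChar K (G.eval x) = 1 ↔ G.eval x ^ (ρ * (p ^ μ + 1)) = 1) ∧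
          (quadraticChar K (G.eval x) = -1 ↔ G.eval x ^ (ρ * (p ^ μ + 1)) = -1) := by
        intro x
        have h1 := quadraticChar_eq_pow_of_char_ne_two' hchar (G.eval x)
        rw [hexp] at h1
        rw [← h1]
        have hne : (-1 : K) ≠ 1 := Ring.neg_one_ne_one_of_char_ne_two hchar
        by_cases h : G.eval x = 0
        · simp [h]
        · rcases quadraticChar_dichotomy h with h | h <;> simp [h, hne, hne.symm]
      have hp1 := card_filter_eval_pow_eq_le hG (hGd ▸ hdeg) hG0 hρ hcard hbig
        (one_ne_zero (α := K))
      have hm1 := card_filter_eval_pow_eq_le hG (hGd ▸ hdeg) hG0 hρ hcard hbig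
        (neg_ne_zero.2 (one_ne_zero (α := K)))
      simp only [← (chi _).1, ← (chi _).2] at hp1 hm1
      have h0 : (Finset.univ.filter fun x : K => G.eval x = 0).card ≤ G.natDegree := by
        refine card_le_degree_of_subset_roots ?_
        intro x hx
        rw [mem_roots hG.ne_zero]
        simpa using hx
      set P := Finset.univ.filter fun x : K => quadraticChar K (G.eval x) = 1
      set N := Finset.univ.filter fun x : K => quadraticChar K (G.eval x) = -1
      set Z := Finset.univ.filter fun x : K => G.eval x = 0
      have hsum : ∑ x : K, quadraticChar K (G.eval x) = (P.card : ℤ) - N.card := by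
        simp only [P, N, Finset.card_filter, Nat.cast_sum, ← Finset.sum_sub_distrib]
        refine Finset.sum_congr rfl fun x _ => ?_
        by_cases h : G.eval x = 0
        · simp [h]
        · rcases quadraticChar_dichotomy h with h | h <;> simp [h]
      have htot : (Fintype.card K : ℤ) = P.card + N.card + Z.card := by
        rw [← Finset.card_univ, Finset.card_eq_sum_ones]
        simp only [P, N, Z, Finset.card_filter, Nat.cast_sum, ← Finset.sum_add_distrib]
        refine Finset.sum_congr rfl fun x _ => ?_
        by_cases h : G.eval x = 0
        · simp [h]
        · rcases quadraticChar_dichotomy h with h' | h' <;> simp [h', h]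
      rw [hcard] at htot
      rw [hsum, abs_le]
      rw [hGd] at hp1 hm1 h0
      zify at hp1 hm1 h0 hpr
      push_cast at htot
      constructor <;> nlinarith
    · refine triv.trans ?_
      rw [hcard]
      push Not at hbig
      rw [hGd] at hbig
      zify at hbig
      push_cast
      nlinarith
  -- A translation makes the constant term nonzero, as the independence argument requires.
  by_cases h : ∃ c, F.eval c ≠ 0
  · obtain ⟨c, hc⟩ := h
    have h1 := key (F.comp (X + C c)) ?_ ?_ ?_
    · have e : ∑ x : K, quadraticChar K ((F.comp (X + C c)).eval x)
          = ∑ x : K, quadraticChar K (F.eval x) := by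
        simp only [eval_comp, eval_add, eval_X, eval_C]
        exact Equiv.sum_comp (Equiv.addRight c) fun x => quadraticChar K (F.eval x)
      rwa [e] at h1
    · rintro d ⟨e, he⟩
      have h2 : F = d.comp (X - C c) * d.comp (X - C c) * e.comp (X - C c) := by
        rw [← mul_comp, ← mul_comp, ← he, comp_assoc]
        simp
      have h3 : IsUnit (d.comp (X - C c)) := hF _ ⟨_, h2⟩
      have h4 := h3.map (compRingHom (X + C c))
      simpa [comp_assoc] using h4
    · simp [natDegree_comp]
    · simpa [eval_comp] using hc
  · push Not at h
    simp only [h, MulChar.map_zero, Finset.sum_const_zero, abs_zero]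
    positivity

end StepanovCount

/-! ### Characteristic polynomials of field elements: trace and norm -/

section FieldPoly

open IntermediateField Module

variable {K L : Type*} [Field K] [Field L] [Algebra K L]

/-- The characteristic polynomial over `K` of multiplication by `x : L`, as a power of the
minimal polynomial. -/
noncomputable def fieldPoly (K : Type*) {L : Type*} [Field K] [Field L] [Algebra K L] (x : L) :
    K[X] :=
  minpoly K x ^ finrank K⟮x⟯ L

theorem fieldPoly_monic [FiniteDimensional K L] (x : L) : (fieldPoly K x).Monic :=
  (minpoly.monic (IsIntegral.of_finite K x)).pow _

theorem natDegree_minpoly_mul_finrank [FiniteDimensional K L] (x : L) :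
    (minpoly K x).natDegree * finrank K⟮x⟯ L = finrank K L := by
  rw [← adjoin.finrank (IsIntegral.of_finite K x)]
  exact Module.finrank_mul_finrank _ _ _

theorem natDegree_fieldPoly [FiniteDimensional K L] (x : L) :
    (fieldPoly K x).natDegree = finrank K L := by
  rw [fieldPoly, natDegree_pow, mul_comm, natDegree_minpoly_mul_finrank]

theorem nextCoeff_fieldPoly [FiniteDimensional K L] (x : L) :
    (fieldPoly K x).nextCoeff = - Algebra.trace K L x := by
  rw [fieldPoly, (minpoly.monic (IsIntegral.of_finite K x)).nextCoeff_pow,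
    trace_eq_finrank_mul_minpoly_nextCoeff]
  simp

theorem PowerBasis.norm_algebraMap_sub_gen {S : Type*} [CommRing S] [Algebra K S]
    (pb : PowerBasis K S) (a : K) :
    Algebra.norm K (algebraMap K S a - pb.gen) = (minpoly K pb.gen).eval a := by
  rw [Algebra.norm_eq_matrix_det pb.basis, ← charpoly_leftMulMatrix, Matrix.eval_charpoly,
    map_sub]
  congr 2
  exact AlgHom.commutes _ _

theorem eval_fieldPoly [FiniteDimensional K L] (x : L) (a : K) :
    (fieldPoly K x).eval a = Algebra.norm K (algebraMap K L a - x) := by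
  have hx := IsIntegral.of_finite K x
  have h1 := PowerBasis.norm_algebraMap_sub_gen (adjoin.powerBasis hx) a
  rw [adjoin.powerBasis_gen hx, minpoly_gen] at h1
  have e : algebraMap K L a - x
      = algebraMap K⟮x⟯ L (algebraMap K K⟮x⟯ a - AdjoinSimple.gen K x) := by
    rw [map_sub, AdjoinSimple.algebraMap_gen, ← IsScalarTower.algebraMap_apply]
  rw [e, ← Algebra.norm_norm (S := K⟮x⟯), Algebra.norm_algebraMap, map_pow, h1, fieldPoly, eval_pow]

end FieldPoly

/-! ### Sums over monic polynomials -/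

section MonicSums

variable {K : Type*} [Field K] [Fintype K] [DecidableEq K]

/-- The monic polynomials of degree `n` over a finite field. -/
noncomputable def monicFinset (K : Type*) [Field K] [Fintype K] [DecidableEq K] (n : ℕ) :
    Finset K[X] :=
  Finset.univ.image fun v : Fin n → K => X ^ n + ((degreeLTEquiv K n).symm v : K[X])

theorem mem_monicFinset {n : ℕ} {g : K[X]} : g ∈ monicFinset K n ↔ g.Monic ∧ g.natDegree = n := by
  simp only [monicFinset, Finset.mem_image, Finset.mem_univ, true_and]
  constructor
  · rintro ⟨v, rfl⟩
    have h := mem_degreeLT.1 ((degreeLTEquiv K n).symm v).2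
    have hm : (X ^ n + ((degreeLTEquiv K n).symm v : K[X])).Monic := monic_X_pow_add h
    refine ⟨hm, ?_⟩
    have : (X ^ n + ((degreeLTEquiv K n).symm v : K[X])).degree = (n : WithBot ℕ) := by
      rw [degree_add_eq_left_of_degree_lt (by rwa [degree_X_pow]), degree_X_pow]
    exact natDegree_eq_of_degree_eq_some this
  · rintro ⟨hm, hn⟩
    have hd : g - X ^ n ∈ degreeLT K n := by
      rw [mem_degreeLT]
      have hg : g.degree = n := by rw [degree_eq_natDegree hm.ne_zero, hn]
      rw [← hg]
      refine degree_sub_lt_left ?_ hm.ne_zero ?_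
      · rw [degree_X_pow, hg]
      · rw [hm.leadingCoeff, (monic_X_pow n).leadingCoeff]
    exact ⟨degreeLTEquiv K n ⟨_, hd⟩, by simp⟩

theorem sum_monicFinset_filter_dvd (lam : K[X] → ℂ)
    (hmul : ∀ f g, f.Monic → g.Monic → lam (f * g) = lam f * lam g) {h : K[X]} (hh : h.Monic)
    {n : ℕ} (hn : h.natDegree ≤ n) [DecidablePred (h ∣ ·)] :
    ∑ g ∈ (monicFinset K n).filter (h ∣ ·), lam g
      = lam h * ∑ g ∈ monicFinset K (n - h.natDegree), lam g := by
  classical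
  rw [Finset.mul_sum]
  symm
  refine Finset.sum_bij (fun g _ => h * g) ?_ ?_ ?_ ?_
  · intro g hg
    rw [mem_monicFinset] at hg
    rw [Finset.mem_filter, mem_monicFinset]
    refine ⟨⟨hh.mul hg.1, ?_⟩, dvd_mul_right _ _⟩
    rw [hh.natDegree_mul hg.1]
    omega
  · intro a _ b _ hab
    exact mul_left_cancel₀ hh.ne_zero hab
  · intro g hg
    rw [Finset.mem_filter, mem_monicFinset] at hg
    obtain ⟨⟨hm, hd⟩, c, rfl⟩ := hg
    have hc := hh.of_mul_monic_left hm
    refine ⟨c, ?_, rfl⟩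
    rw [mem_monicFinset]
    refine ⟨hc, ?_⟩
    rw [hh.natDegree_mul hc] at hd
    omega
  · intro g hg
    rw [hmul _ _ hh (mem_monicFinset.1 hg).1]

end MonicSums

/-! ### Euler product and its logarithmic derivative -/

section Count

open Module IntermediateField

variable {p : ℕ} [Fact p.Prime]

/-- `P` divides the separable polynomial `X ^ |L| - X`, which splits over `L`, so `P` has as many
roots there as its degree. -/
theorem card_filter_minpoly_eq {L : Type*} [Field L] [Fintype L] [Algebra (ZMod p) L]
    {P : (ZMod p)[X]} (hP : Irreducible P) (hm : P.Monic) [DecidableEq (ZMod p)[X]]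
    (hd : P.natDegree ∣ finrank (ZMod p) L) :
    (Finset.univ.filter fun x : L => minpoly (ZMod p) x = P).card = P.natDegree := by
  classical
  have hcard : Nat.card L = p ^ finrank (ZMod p) L := (FiniteField.pow_finrank_eq_natCard p L).symm
  have hdvd : P ∣ X ^ Nat.card L - X := by
    have := hP.natDegree_dvd_iff_dvd_X_pow_card_pow_sub_X.1 hd
    rwa [Nat.card_zmod, ← hcard] at this
  have hsplit : (P.map (algebraMap (ZMod p) L)).Splits := by
    refine (FiniteField.splits_X_pow_nat_card_sub_X p (K := L)).of_dvd ?_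
      (Polynomial.map_dvd _ hdvd)
    refine (Polynomial.map_ne_zero_iff (algebraMap (ZMod p) L).injective).2 ?_
    exact FiniteField.X_pow_card_sub_X_ne_zero _ Finite.one_lt_card
  rw [← card_rootSet_eq_natDegree (PerfectField.separable_of_irreducible hP) hsplit,
    ← Set.toFinset_card]
  congr 1
  ext x
  simp only [Finset.mem_filter, Finset.mem_univ, true_and, Set.mem_toFinset, mem_rootSet]
  constructor
  · rintro rfl
    exact ⟨hP.ne_zero, minpoly.aeval _ _⟩
  · rintro ⟨-, h⟩
    exact (minpoly.eq_of_irreducible_of_monic hP h hm).symm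

theorem Nat.card_filter_dvd_div_le {n d v : ℕ} (hd : 0 < d) (h : v * d ≤ n) :
    ((Finset.Icc 1 n).filter fun r => d ∣ r ∧ r / d ≤ v).card = v := by
  have : ((Finset.Icc 1 n).filter fun r => d ∣ r ∧ r / d ≤ v)
      = (Finset.Icc 1 v).image (· * d) := by
    ext r
    simp only [Finset.mem_filter, Finset.mem_Icc, Finset.mem_image]
    constructor
    · rintro ⟨⟨h1, -⟩, ⟨j, rfl⟩, h3⟩
      rw [Nat.mul_div_cancel_left _ hd] at h3
      exact ⟨j, ⟨Nat.pos_of_mul_pos_left h1, h3⟩, mul_comm _ _⟩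
    · rintro ⟨j, ⟨h1, h2⟩, rfl⟩
      refine ⟨⟨Nat.mul_pos h1 hd, (Nat.mul_le_mul_right _ h2).trans h⟩, dvd_mul_left _ _, ?_⟩
      rwa [Nat.mul_div_cancel _ hd]
  rw [this, Finset.card_image_of_injective _ (fun a b hab => Nat.eq_of_mul_eq_mul_right hd hab)]
  simp

noncomputable instance (r : ℕ) : Fintype (GaloisField p r) := Fintype.ofFinite _

/-- The degree of `g` counts the elements of finite fields whose characteristic polynomial
divides `g`. -/
theorem sum_card_filter_fieldPoly_dvd [DecidableEq (ZMod p)[X]] {g : (ZMod p)[X]} (hg : g.Monic)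
    [∀ h : (ZMod p)[X], Decidable (h ∣ g)] :
    ∑ r ∈ Finset.Icc 1 g.natDegree,
      (Finset.univ.filter fun x : GaloisField p r => fieldPoly (ZMod p) x ∣ g).card
      = g.natDegree := by
  classical
  set S := (UniqueFactorizationMonoid.normalizedFactors g).toFinset with hS
  set v : (ZMod p)[X] → ℕ := fun P =>
    Multiset.count P (UniqueFactorizationMonoid.normalizedFactors g) with hv
  have hmemS : ∀ P, P ∈ S ↔ Irreducible P ∧ P.Monic ∧ P ∣ g := fun P => by
    rw [hS, Multiset.mem_toFinset, Polynomial.mem_normalizedFactors_iff hg.ne_zero]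
  have hdvd : ∀ P ∈ S, ∀ j, P ^ j ∣ g ↔ j ≤ v P := by
    intro P hP j
    obtain ⟨hi, hm, -⟩ := (hmemS P).1 hP
    rw [pow_dvd_iff_le_emultiplicity,
      UniqueFactorizationMonoid.emultiplicity_eq_count_normalizedFactors hi hg.ne_zero,
      hm.normalize_eq_self]
    exact Nat.cast_le
  have hdegsum : g.natDegree = ∑ P ∈ S, v P * P.natDegree := by
    conv_lhs => rw [← hg.normalize_eq_self,
      ← UniqueFactorizationMonoid.prod_normalizedFactors_eq hg.ne_zero]
    rw [natDegree_multiset_prod_of_monic, Finset.sum_multiset_map_count]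
    · simp only [smul_eq_mul]
      rfl
    · intro f hf
      exact ((Polynomial.mem_normalizedFactors_iff hg.ne_zero).1 hf).2.1
  -- An element with minimal polynomial `P` of degree `d ∣ r` has `fieldPoly` equal to `P ^ (r /
  -- d)`, and there are `d` of them. So `P` contributes `d` for each of the `v P` multiples `r` of
  -- `d` with `r / d ≤ v P`.
  have hcount : ∀ r ∈ Finset.Icc 1 g.natDegree,
      (Finset.univ.filter fun x : GaloisField p r => fieldPoly (ZMod p) x ∣ g).card
      = ∑ P ∈ S, if P.natDegree ∣ r ∧ r / P.natDegree ≤ v P then P.natDegree else 0 := by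
    intro r hr
    have hr0 : r ≠ 0 := by have := Finset.mem_Icc.1 hr; omega
    have hfin : finrank (ZMod p) (GaloisField p r) = r := GaloisField.finrank p hr0
    rw [Finset.card_eq_sum_card_fiberwise (f := fun x : GaloisField p r => minpoly (ZMod p) x)
      (t := S)]
    · refine Finset.sum_congr rfl fun P hP => ?_
      obtain ⟨hi, hm, -⟩ := (hmemS P).1 hP
      have hpow : ∀ x : GaloisField p r, minpoly (ZMod p) x = P →
          P.natDegree ∣ r ∧ fieldPoly (ZMod p) x = P ^ (r / P.natDegree) := by
        rintro x rfl
        have h1 := natDegree_minpoly_mul_finrank (K := ZMod p) x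
        rw [hfin] at h1
        refine ⟨⟨_, h1.symm⟩, ?_⟩
        rw [fieldPoly, ← Nat.eq_div_of_mul_eq_right hi.natDegree_pos.ne' h1]
      split_ifs with h
      · rw [← card_filter_minpoly_eq (L := GaloisField p r) hi hm (by rw [hfin]; exact h.1),
          Finset.filter_filter]
        congr 1
        refine Finset.filter_congr fun x _ => ⟨fun hx => hx.2, fun hx => ⟨?_, hx⟩⟩
        rw [(hpow x hx).2, hdvd P hP]
        exact h.2
      · rw [Finset.card_eq_zero, Finset.filter_filter, Finset.filter_eq_empty_iff]
        rintro x - ⟨h1, h2⟩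
        refine h ⟨(hpow x h2).1, ?_⟩
        rwa [← hdvd P hP, ← (hpow x h2).2]
    · intro x hx
      have hx' : fieldPoly (ZMod p) x ∣ g := by simpa using hx
      rw [Finset.mem_coe, hmemS]
      have hint := IsIntegral.of_finite (ZMod p) x
      refine ⟨minpoly.irreducible hint, minpoly.monic hint, (dvd_pow_self _ ?_).trans hx'⟩
      exact finrank_pos.ne'
  rw [Finset.sum_congr rfl hcount, Finset.sum_comm]
  conv_rhs => rw [hdegsum]
  refine Finset.sum_congr rfl fun P hP => ?_
  obtain ⟨hi, hm, -⟩ := (hmemS P).1 hP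
  rw [← Finset.sum_filter, Finset.sum_const, smul_eq_mul, Nat.card_filter_dvd_div_le hi.natDegree_pos]
  rw [hdegsum]
  exact Finset.single_le_sum (f := fun P => v P * P.natDegree) (fun _ _ => Nat.zero_le _) hP

/-- The logarithmic derivative of the Euler product of a completely multiplicative function on
monic polynomials. -/
theorem mul_sum_monicFinset_eq (lam : (ZMod p)[X] → ℂ)
    (hmul : ∀ f g, f.Monic → g.Monic → lam (f * g) = lam f * lam g) (n : ℕ) :
    n * ∑ g ∈ monicFinset (ZMod p) n, lam g
      = ∑ r ∈ Finset.Icc 1 n, (∑ x : GaloisField p r, lam (fieldPoly (ZMod p) x)) *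
          ∑ g ∈ monicFinset (ZMod p) (n - r), lam g := by
  classical
  have h1 : ∀ g ∈ monicFinset (ZMod p) n, (n : ℂ) * lam g
      = ∑ r ∈ Finset.Icc 1 n, ∑ x : GaloisField p r,
        if fieldPoly (ZMod p) x ∣ g then lam g else 0 := by
    intro g hg
    obtain ⟨hm, rfl⟩ := mem_monicFinset.1 hg
    conv_lhs => rw [← sum_card_filter_fieldPoly_dvd hm]
    rw [Nat.cast_sum, Finset.sum_mul]
    refine Finset.sum_congr rfl fun r _ => ?_
    rw [← Finset.sum_filter, Finset.sum_const, nsmul_eq_mul]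
  rw [Finset.mul_sum, Finset.sum_congr rfl h1, Finset.sum_comm]
  refine Finset.sum_congr rfl fun r hr => ?_
  rw [Finset.sum_comm, Finset.sum_mul]
  refine Finset.sum_congr rfl fun x _ => ?_
  have hr' := Finset.mem_Icc.1 hr
  have hfin : finrank (ZMod p) (GaloisField p r) = r := GaloisField.finrank p (by omega)
  have hdeg := natDegree_fieldPoly (K := ZMod p) x
  rw [hfin] at hdeg
  rw [← Finset.sum_filter, sum_monicFinset_filter_dvd lam hmul (fieldPoly_monic x)
    (by omega), hdeg]

end Count

/-! ### Power sums: Newton's identities and bounds on the summands -/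

section PowerSums

/-- Newton's identities characterise power sums. -/
theorem eq_neg_sum_pow_of_recurrence {m : ℕ} (c s : ℕ → ℂ) (hc0 : c 0 = 1)
    (hc : ∀ n, m < n → c n = 0)
    (hrec : ∀ n : ℕ, (n : ℂ) * c n = ∑ r ∈ Finset.Icc 1 n, s r * c (n - r)) :
    ∃ ω : Fin m → ℂ, ∀ n, 1 ≤ n → s n = -∑ i, ω i ^ n := by
  classical
  -- The reciprocal polynomial of `∑ c n * T ^ n`. Its roots are the `ω`, so `c k` is `(-1) ^ k`
  -- times their elementary symmetric function. Since `c 0 = 1`, the recurrence determines `s`.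
  set Q : ℂ[X] := X ^ m + ∑ i ∈ Finset.range m, C (c (m - i)) * X ^ i with hQ
  have hlow : (∑ i ∈ Finset.range m, C (c (m - i)) * X ^ i : ℂ[X]).degree < m := by
    refine lt_of_le_of_lt (degree_sum_le _ _) ((Finset.sup_lt_iff (WithBot.bot_lt_coe m)).2 ?_)
    intro i hi
    exact lt_of_le_of_lt (degree_C_mul_X_pow_le _ _) (Nat.cast_lt.2 (Finset.mem_range.1 hi))
  have hQm : Q.Monic := monic_X_pow_add hlow
  have hQd : Q.natDegree = m := by
    refine natDegree_eq_of_degree_eq_some ?_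
    rw [hQ, degree_add_eq_left_of_degree_lt (by rwa [degree_X_pow]), degree_X_pow]
  have hQc : ∀ i ≤ m, Q.coeff (m - i) = c i := by
    intro i hi
    rw [hQ, coeff_add, coeff_X_pow, finsetSum_coeff]
    simp only [coeff_C_mul_X_pow]
    rcases Nat.eq_zero_or_pos i with rfl | hpos
    · rw [Finset.sum_eq_zero]
      · simp [hc0]
      · intro j hj
        have := Finset.mem_range.1 hj
        rw [if_neg (by omega)]
    · rw [if_neg (by omega), Finset.sum_ite_eq, if_pos (Finset.mem_range.2 (by omega)), zero_add]
      congr 1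
      omega
  have hroots : Q.roots.card = Q.natDegree := (IsAlgClosed.splits Q).natDegree_eq_card_roots.symm
  obtain ⟨ω, hω⟩ : ∃ ω : Fin m → ℂ, Multiset.map ω Finset.univ.val = Q.roots := by
    obtain ⟨l, hl⟩ := Quot.exists_rep Q.roots
    have hlen : l.length = m := by
      rw [← hQd, ← hroots, ← hl]
      rfl
    subst hlen
    refine ⟨l.get, ?_⟩
    rw [← hl]
    simp [Fin.univ_val_map]
  refine ⟨ω, ?_⟩
  set e : ℕ → ℂ := fun k => MvPolynomial.aeval ω (MvPolynomial.esymm (Fin m) ℂ k) with he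
  have hce : ∀ k, c k = (-1) ^ k * e k := by
    intro k
    have he' : e k = Q.roots.esymm k := by
      rw [he]
      simp only [MvPolynomial.aeval_esymm_eq_multiset_esymm, hω]
    rcases le_or_gt k m with hk | hk
    · rw [← hQc k hk, coeff_eq_esymm_roots_of_card hroots (by omega), hQm.leadingCoeff, hQd, he',
        Nat.sub_sub_self hk, one_mul]
    · rw [hc k hk, he', Multiset.esymm, Multiset.powersetCard_eq_empty _ (by omega)]
      simp
  have hnewton : ∀ n : ℕ, (n : ℂ) * c n
      = ∑ r ∈ Finset.Icc 1 n, (-∑ i, ω i ^ r) * c (n - r) := by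
    intro n
    have h := congrArg (MvPolynomial.aeval ω) (MvPolynomial.mul_esymm_eq_sum (Fin m) ℂ n)
    simp only [map_mul, map_sum, map_pow, map_neg, map_one, map_natCast, MvPolynomial.psum,
      MvPolynomial.aeval_X] at h
    change (n : ℂ) * e n = _ at h
    rw [hce, mul_left_comm, h, ← mul_assoc, ← pow_add, Finset.mul_sum]
    refine Finset.sum_bij (fun a _ => a.2) ?_ ?_ ?_ ?_
    · intro a ha
      simp only [Finset.mem_filter, Finset.HasAntidiagonal.mem_antidiagonal] at ha
      rw [Finset.mem_Icc]
      omega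
    · intro a ha b hb hab
      simp only [Finset.mem_filter, Finset.HasAntidiagonal.mem_antidiagonal] at ha hb
      ext <;> omega
    · intro r hr
      rw [Finset.mem_Icc] at hr
      refine ⟨(n - r, r), ?_, rfl⟩
      simp only [Finset.mem_filter, Finset.HasAntidiagonal.mem_antidiagonal]
      omega
    · intro a ha
      simp only [Finset.mem_filter, Finset.HasAntidiagonal.mem_antidiagonal] at ha
      have h1 : n - a.2 = a.1 := by omega
      rw [h1, hce]
      have h2 : ((-1 : ℂ)) ^ (n + (n + 1)) = -1 := by
        rw [← add_assoc, pow_succ, ← two_mul, pow_mul]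
        simp
      rw [h2]
      simp only [e]
      ring
  intro n
  induction n using Nat.strong_induction_on with
  | _ n ih =>
    intro hn
    have h1 := hrec n
    rw [hnewton n] at h1
    obtain ⟨k, rfl⟩ : ∃ k, n = k + 1 := ⟨n - 1, by omega⟩
    rw [Finset.sum_Icc_succ_top (by omega), Finset.sum_Icc_succ_top (by omega), Nat.sub_self, hc0,
      mul_one, mul_one] at h1
    have h2 : ∑ r ∈ Finset.Icc 1 k, s r * c (k + 1 - r)
        = ∑ r ∈ Finset.Icc 1 k, (-∑ i, ω i ^ r) * c (k + 1 - r) := by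
      refine Finset.sum_congr rfl fun r hr => ?_
      have := Finset.mem_Icc.1 hr
      rw [ih r (by omega) (by omega)]
    rw [h2] at h1
    exact (add_left_cancel h1).symm

/-- Compactness of the torus: a subsequence of powers is Cauchy, and the quotient of two late terms
is a high power close to `1` in every coordinate. -/
theorem exists_pow_near_one {ι : Type*} [Fintype ι] (z : ι → ℂ) (hz : ∀ i, ‖z i‖ = 1) (N : ℕ) :
    ∃ n, N ≤ n ∧ 1 ≤ n ∧ ∀ i, 1 / 2 ≤ (z i ^ n).re := by
  obtain ⟨a, -, φ, hφ, hlim⟩ := (isCompact_closedBall (0 : ι → ℂ) 1).tendsto_subseq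
    (x := fun n => z ^ n) (fun n => by
      rw [mem_closedBall_zero_iff, pi_norm_le_iff_of_nonneg zero_le_one]
      intro i
      simp [hz])
  have hc := hlim.cauchySeq
  rw [Metric.cauchySeq_iff] at hc
  obtain ⟨M, hM⟩ := hc (1 / 2) (by norm_num)
  have hle := hφ.add_le_nat (N + 1) M
  set n := φ (N + 1 + M) - φ M with hn
  refine ⟨n, by omega, by omega, fun i => ?_⟩
  have hd := hM (N + 1 + M) (by omega) M le_rfl
  have hd' : dist (z i ^ φ (N + 1 + M)) (z i ^ φ M) < 1 / 2 :=
    lt_of_le_of_lt (dist_le_pi_dist (z ^ φ (N + 1 + M)) (z ^ φ M) i) hd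
  have h1 : ‖z i ^ n - 1‖ < 1 / 2 := by
    have e : z i ^ φ (N + 1 + M) - z i ^ φ M = (z i ^ n - 1) * z i ^ φ M := by
      rw [sub_mul, ← pow_add, one_mul]
      congr 2
      omega
    rwa [dist_eq_norm, e, norm_mul, norm_pow (z i) (φ M), hz, one_pow, mul_one] at hd'
  have h2 := (Complex.abs_re_le_norm (z i ^ n - 1)).trans h1.le
  rw [Complex.sub_re, Complex.one_re, abs_le] at h2
  linarith [h2.1]

/-- A bound on all power sums of a family bounds its members. -/
theorem norm_le_of_norm_sum_pow_le {ι : Type*} [Fintype ι] (η : ι → ℂ) {C R : ℝ} (hR : 0 < R)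
    (h : ∀ n, 1 ≤ n → ‖∑ i, η i ^ n‖ ≤ C * R ^ n) (i : ι) : ‖η i‖ ≤ R := by
  by_contra! hi
  let z : ι → ℂ := fun j => Complex.exp (Complex.arg (η j) * Complex.I)
  have hz : ∀ j, η j = ‖η j‖ * z j := fun j => (Complex.norm_mul_exp_arg_mul_I _).symm
  have h1 : 1 < ‖η i‖ / R := (one_lt_div hR).2 hi
  obtain ⟨N, hN⟩ := pow_unbounded_of_one_lt (2 * C) h1
  obtain ⟨n, hn, hn1, hre⟩ := exists_pow_near_one z
    (fun j => Complex.norm_exp_ofReal_mul_I _) N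
  -- For this `n` every `η j ^ n` has nonnegative real part, at least half its modulus, so nothing
  -- cancels.
  have h2 : ‖η i‖ ^ n / 2 ≤ ‖∑ j, η j ^ n‖ := by
    refine le_trans ?_ (Complex.re_le_norm _)
    rw [Complex.re_sum]
    have hj : ∀ j, ‖η j‖ ^ n / 2 ≤ (η j ^ n).re := by
      intro j
      have : η j ^ n = ((‖η j‖ ^ n : ℝ) : ℂ) * z j ^ n := by
        conv_lhs => rw [hz j, mul_pow]
        push_cast
        rfl
      rw [this, Complex.re_ofReal_mul]
      have := hre j
      have h0 : 0 ≤ ‖η j‖ ^ n := by positivity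
      nlinarith
    refine (hj i).trans ?_
    refine Finset.single_le_sum (f := fun j => (η j ^ n).re) (fun j _ => ?_) (Finset.mem_univ i)
    exact le_trans (by positivity) (hj j)
  have h3 := h2.trans (h n hn1)
  have h4 : (‖η i‖ / R) ^ n ≤ 2 * C := by
    rw [div_pow, div_le_iff₀ (by positivity)]
    linarith
  have h5 := pow_le_pow_right₀ h1.le hn
  linarith

end PowerSums

/-! ### Norm, trace and the additive Hilbert 90 over finite fields -/

section FiniteFieldMaps

open Module

variable {p : ℕ} [Fact p.Prime] {L : Type*} [Field L] [Fintype L] [Algebra (ZMod p) L]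

/-- Euler's criterion on both sides: the norm is the power `(q - 1) / (p - 1)`, and raising it to
`(p - 1) / 2` gives the power `(q - 1) / 2`. -/
theorem quadraticChar_norm [DecidableEq L] (hp : p ≠ 2) (y : L) :
    quadraticChar (ZMod p) (Algebra.norm (ZMod p) y) = quadraticChar L y := by
  have : CharP L p := charP_of_injective_algebraMap (algebraMap (ZMod p) L).injective p
  have hodd : Odd p := (Fact.out : p.Prime).odd_of_ne_two hp
  have hcL : ringChar L ≠ 2 := by rwa [ringChar.eq L p]
  have hcK : ringChar (ZMod p) ≠ 2 := by rwa [ringChar.eq (ZMod p) p]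
  have h1 := congrArg (algebraMap (ZMod p) L)
    (quadraticChar_eq_pow_of_char_ne_two' hcK (Algebra.norm (ZMod p) y))
  have h2 := quadraticChar_eq_pow_of_char_ne_two' hcL y
  rw [map_pow, FiniteField.algebraMap_norm_eq_pow, ← pow_mul, ZMod.card, Nat.card_zmod,
    Nat.card_eq_fintype_card] at h1
  have hexp : (Fintype.card L - 1) / (p - 1) * (p / 2) = Fintype.card L / 2 := by
    obtain ⟨h, hh⟩ := hodd
    have hq : Fintype.card L = p ^ finrank (ZMod p) L := by
      rw [← Nat.card_eq_fintype_card, FiniteField.pow_finrank_eq_natCard]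
    have hh0 : 0 < h := by have := (Fact.out : p.Prime).two_le; omega
    obtain ⟨t, ht⟩ : p - 1 ∣ Fintype.card L - 1 := by
      rw [hq]
      simpa using Nat.sub_dvd_pow_sub_pow p 1 (finrank (ZMod p) L)
    have hp1 : p - 1 = 2 * h := by omega
    have hp2 : p / 2 = h := by omega
    have hpos : 0 < Fintype.card L := Fintype.card_pos
    rw [ht, Nat.mul_div_cancel_left _ (by omega), hp2]
    rw [hp1, mul_assoc] at ht
    rw [mul_comm t h]
    omega
  rw [hexp, ← h2, map_intCast] at h1
  by_cases hy : y = 0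
  · simp [hy]
  · have hN : Algebra.norm (ZMod p) y ≠ 0 := Algebra.norm_ne_zero_iff.2 hy
    have hne : (-1 : L) ≠ 1 := Ring.neg_one_ne_one_of_char_ne_two hcL
    rcases quadraticChar_dichotomy hN with h | h <;>
      rcases quadraticChar_dichotomy hy with h' | h' <;> rw [h, h'] at h1 ⊢ <;> push_cast at h1
    · exact absurd h1.symm hne
    · exact absurd h1 hne

theorem card_filter_trace_eq_zero_mul [DecidableEq (ZMod p)] :
    (Finset.univ.filter fun x : L => Algebra.trace (ZMod p) L x = 0).card * p
      = Fintype.card L := by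
  classical
  have hs : Function.Surjective (Algebra.trace (ZMod p) L) := Algebra.trace_surjective _ _
  have h := (Algebra.trace (ZMod p) L).finrank_range_add_finrank_ker
  rw [LinearMap.range_eq_top.2 hs, finrank_top, finrank_self] at h
  have h1 : Fintype.card (LinearMap.ker (Algebra.trace (ZMod p) L))
      = p ^ finrank (ZMod p) (LinearMap.ker (Algebra.trace (ZMod p) L)) := by
    rw [Module.card_eq_pow_finrank (K := ZMod p), ZMod.card]
  have h2 : Fintype.card L = p ^ finrank (ZMod p) L := by
    rw [Module.card_eq_pow_finrank (K := ZMod p), ZMod.card]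
  have h3 : (Finset.univ.filter fun x : L => Algebra.trace (ZMod p) L x = 0).card
      = Fintype.card (LinearMap.ker (Algebra.trace (ZMod p) L)) := by
    rw [Fintype.card_subtype]
    congr 1
    ext x
    simp
  rw [h3, h1, h2, ← h, add_comm, pow_succ]

theorem trace_pow_prime (z : L) : Algebra.trace (ZMod p) L (z ^ p) = Algebra.trace (ZMod p) L z := by
  have := Algebra.trace_eq_of_algEquiv (FiniteField.frobeniusAlgEquivOfAlgebraic (ZMod p) L) z
  rwa [FiniteField.coe_frobeniusAlgEquivOfAlgebraic, ZMod.card] at this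

/-- The additive form of Hilbert's theorem 90, with the size of the fibres. -/
theorem card_filter_pow_sub_eq [DecidableEq L] (x : L) :
    (Finset.univ.filter fun z : L => z ^ p - z = x).card
      = if Algebra.trace (ZMod p) L x = 0 then p else 0 := by
  have hp1 : 1 < p := (Fact.out : p.Prime).one_lt
  have hle : ∀ x : L, (Finset.univ.filter fun z : L => z ^ p - z = x).card ≤ p := by
    intro x
    have hd : (X ^ p - X - C x : L[X]).natDegree = p := by
      rw [natDegree_sub_C, FiniteField.X_pow_card_sub_X_natDegree_eq L hp1]
    have h0 : (X ^ p - X - C x : L[X]) ≠ 0 := by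
      intro h
      rw [h, natDegree_zero] at hd
      omega
    conv_rhs => rw [← hd]
    refine card_le_degree_of_subset_roots ?_
    intro z hz
    rw [mem_roots h0]
    simpa [sub_eq_zero] using hz
  have hzero : ∀ x : L, Algebra.trace (ZMod p) L x ≠ 0 →
      (Finset.univ.filter fun z : L => z ^ p - z = x).card = 0 := by
    intro x hx
    rw [Finset.card_eq_zero, Finset.filter_eq_empty_iff]
    rintro z - rfl
    rw [map_sub, trace_pow_prime, sub_self] at hx
    exact hx rfl
  -- The pointwise upper bounds on the fibres have the same total as the fibres themselves, namely
  -- `|L|`, so each of them is an equality.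
  have hsum : ∑ x : L, (Finset.univ.filter fun z : L => z ^ p - z = x).card = Fintype.card L := by
    rw [← Finset.card_univ (α := L)]
    exact (Finset.card_eq_sum_card_fiberwise fun _ _ => Finset.mem_coe.2 (Finset.mem_univ _)).symm
  have hsum2 : ∑ x : L, (if Algebra.trace (ZMod p) L x = 0 then p else 0) = Fintype.card L := by
    rw [← Finset.sum_filter, Finset.sum_const, smul_eq_mul, card_filter_trace_eq_zero_mul]
  have hall : ∀ x ∈ Finset.univ, (Finset.univ.filter fun z : L => z ^ p - z = x).card
      ≤ if Algebra.trace (ZMod p) L x = 0 then p else 0 := by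
    intro x _
    split_ifs with h
    · exact hle x
    · exact (hzero x h).le
  exact (Finset.sum_eq_sum_iff_of_le hall).1 (hsum.trans hsum2.symm) x (Finset.mem_univ x)

theorem sum_comp_pow_sub [DecidableEq L] (G : L → ℂ) :
    ∑ z : L, G (z ^ p - z) = ∑ x : L, G x * if Algebra.trace (ZMod p) L x = 0 then (p : ℂ) else 0 := by
  rw [← Finset.sum_fiberwise (g := fun z : L => z ^ p - z)]
  refine Finset.sum_congr rfl fun x _ => ?_
  rw [Finset.sum_congr rfl (g := fun _ => G x), Finset.sum_const, card_filter_pow_sub_eq]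
  · split_ifs <;> simp [mul_comm]
  · intro z hz
    rw [(Finset.mem_filter.1 hz).2]

end FiniteFieldMaps

/-! ### The Artin–Schreier product polynomial -/

section ArtinSchreier

variable {p : ℕ} [Fact p.Prime] {L : Type*} [Field L]

/-- The factors differ by nonzero constants, hence are coprime, and each has derivative `1`. -/
theorem squarefree_prod_C_sub_artinSchreier {p : ℕ} [CharP L p] {m : ℕ} {b : Fin m → L}
    (hb : Function.Injective b) :
    Squarefree (∏ i, (C (b i) - (X ^ p - X)) : L[X]) := by
  refine (separable_prod (fun i j hij => ?_) fun i => ?_).squarefree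
  · have hne : b i - b j ≠ 0 := sub_ne_zero.2 (hb.ne hij)
    refine ⟨C (b i - b j)⁻¹, -C (b i - b j)⁻¹, ?_⟩
    have : (C (b i - b j)⁻¹ : L[X]) * C (b i - b j) = 1 := by
      rw [← C_mul, inv_mul_cancel₀ hne, C_1]
    rw [← this, C_sub]
    ring
  · rw [separable_def]
    have : derivative (C (b i) - (X ^ p - X) : L[X]) = 1 := by
      simp [derivative_X_pow]
    rw [this]
    exact isCoprime_one_right

theorem natDegree_prod_C_sub_artinSchreier {m : ℕ} (b : Fin m → L) :
    (∏ i, (C (b i) - (X ^ p - X)) : L[X]).natDegree = m * p := by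
  have hp1 : 1 < p := (Fact.out : p.Prime).one_lt
  have hd : ∀ i, (C (b i) - (X ^ p - X) : L[X]).natDegree = p := by
    intro i
    rw [← neg_sub, natDegree_neg, natDegree_sub_C, FiniteField.X_pow_card_sub_X_natDegree_eq L hp1]
  rw [natDegree_prod]
  · simp [hd]
  · intro i _ h
    have := hd i
    rw [h, natDegree_zero] at this
    omega

end ArtinSchreier

/-! ### The L-function of a hybrid character sum and its Weil bound -/

section HybridSums

variable {p : ℕ} [Fact p.Prime] {m : ℕ}

/-- The completely multiplicative function on monic polynomials attached to the product of
the shifted quadratic characters `x ↦ χ (a i - x)` and an additive character. -/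
noncomputable def hybridChar (a : Fin m → ZMod p) (u : ZMod p) (g : (ZMod p)[X]) : ℂ :=
  ((∏ i, quadraticChar (ZMod p) (g.eval (a i)) : ℤ) : ℂ) * ZMod.stdAddChar (u * g.nextCoeff)

theorem hybridChar_mul (a : Fin m → ZMod p) (u : ZMod p) (f g : (ZMod p)[X]) (hf : f.Monic)
    (hg : g.Monic) : hybridChar a u (f * g) = hybridChar a u f * hybridChar a u g := by
  simp only [hybridChar, eval_mul, map_mul, Finset.prod_mul_distrib, hf.nextCoeff_mul hg, mul_add,
    AddChar.map_add_eq_mul, Int.cast_mul]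
  ring

theorem monicFinset_zero : monicFinset (ZMod p) 0 = {1} := by
  ext g
  rw [mem_monicFinset, Finset.mem_singleton]
  constructor
  · rintro ⟨hm, hd⟩
    exact hm.natDegree_eq_zero.1 hd
  · rintro rfl
    exact ⟨monic_one, natDegree_one⟩

theorem sum_hybridChar_zero (a : Fin m → ZMod p) (u : ZMod p) :
    ∑ g ∈ monicFinset (ZMod p) 0, hybridChar a u g = 1 := by
  rw [monicFinset_zero, Finset.sum_singleton, hybridChar]
  have : (1 : (ZMod p)[X]).nextCoeff = 0 := by simp [nextCoeff]
  simp [this]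

theorem sum_hybridChar_one (a : Fin m → ZMod p) (u : ZMod p) :
    ∑ g ∈ monicFinset (ZMod p) 1, hybridChar a u g
      = ∑ x : ZMod p, ((∏ i, quadraticChar (ZMod p) (a i - x) : ℤ) : ℂ)
          * ZMod.stdAddChar (-(u * x)) := by
  symm
  refine Finset.sum_bij (fun x _ => X - C x) ?_ ?_ ?_ ?_
  · intro x _
    rw [mem_monicFinset]
    exact ⟨monic_X_sub_C x, natDegree_X_sub_C x⟩
  · intro x _ y _ h
    exact C_injective (sub_right_injective h)
  · intro g hg
    rw [mem_monicFinset] at hg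
    refine ⟨-g.coeff 0, Finset.mem_univ _, ?_⟩
    rw [C_neg, sub_neg_eq_add]
    exact (hg.1.as_sum.trans (by simp [hg.2])).symm
  · intro x _
    simp [hybridChar]

theorem sum_quadraticChar_affine (hp : p ≠ 2) (g : ZMod p) {h : ZMod p} (hh : h ≠ 0) :
    ∑ c : ZMod p, quadraticChar (ZMod p) (g + c * h) = 0 := by
  have hcK : ringChar (ZMod p) ≠ 2 := by rwa [ringChar.eq (ZMod p) p]
  rw [← quadraticChar_sum_zero hcK]
  exact Equiv.sum_comp ((Equiv.mulRight₀ h hh).trans (Equiv.addLeft g))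
    fun c => quadraticChar (ZMod p) c

/-- Adding multiples of a polynomial `h` that vanishes at all `a i` except `a i₀` permutes the monic
polynomials. As `deg h = m - 1 < n - 1`, the second coefficient is unchanged, and only `χ (g (a
i₀))` varies, running over a full affine orbit with sum zero. -/
theorem sum_hybridChar_eq_zero (hp : p ≠ 2) {a : Fin m → ZMod p} (ha : Function.Injective a)
    (hm : 0 < m) (u : ZMod p) {n : ℕ} (hn : m < n) :
    ∑ g ∈ monicFinset (ZMod p) n, hybridChar a u g = 0 := by
  classical
  set i₀ : Fin m := ⟨0, hm⟩
  set h : (ZMod p)[X] := ∏ i ∈ Finset.univ.erase i₀, (X - C (a i)) with hh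
  have hhd : h.natDegree = m - 1 := by
    rw [hh, natDegree_prod_of_monic _ _ fun i _ => monic_X_sub_C _]
    simp
  have hh0 : h.eval (a i₀) ≠ 0 := by
    rw [hh, eval_prod, Finset.prod_ne_zero_iff]
    intro i hi
    simpa [sub_eq_zero] using ha.ne (Finset.ne_of_mem_erase hi).symm
  have hhi : ∀ i ∈ Finset.univ.erase i₀, h.eval (a i) = 0 := by
    intro i hi
    rw [hh, eval_prod]
    exact Finset.prod_eq_zero hi (by simp)
  have hmem : ∀ g ∈ monicFinset (ZMod p) n, ∀ c : ZMod p, g + C c * h ∈ monicFinset (ZMod p) n := by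
    intro g hg c
    rw [mem_monicFinset] at hg ⊢
    have hlt : (C c * h).degree < g.degree := by
      refine degree_lt_degree (lt_of_le_of_lt (natDegree_C_mul_le _ _) ?_)
      rw [hhd, hg.2]
      omega
    exact ⟨hg.1.add_of_left hlt, by rw [natDegree_add_eq_left_of_degree_lt hlt, hg.2]⟩
  have hshift : ∀ c : ZMod p, ∑ g ∈ monicFinset (ZMod p) n, hybridChar a u g
      = ∑ g ∈ monicFinset (ZMod p) n, hybridChar a u (g + C c * h) := by
    intro c
    symm
    refine Finset.sum_bij (fun g _ => g + C c * h) (fun g hg => hmem g hg c)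
      (fun g _ g' _ e => add_right_cancel e) (fun g hg => ?_) (fun g _ => rfl)
    exact ⟨g + C (-c) * h, hmem g hg _, by simp⟩
  have hval : ∀ g ∈ monicFinset (ZMod p) n, ∀ c : ZMod p, hybridChar a u (g + C c * h)
      = (quadraticChar (ZMod p) (g.eval (a i₀) + c * h.eval (a i₀)) : ℤ) *
        (((∏ i ∈ Finset.univ.erase i₀, quadraticChar (ZMod p) (g.eval (a i)) : ℤ) : ℂ)
          * ZMod.stdAddChar (u * g.nextCoeff)) := by
    intro g hg c
    have h1 := mem_monicFinset.1 hg
    have h2 := mem_monicFinset.1 (hmem g hg c)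
    have hnext : (g + C c * h).nextCoeff = g.nextCoeff := by
      rw [nextCoeff_of_natDegree_pos (by omega), nextCoeff_of_natDegree_pos (by omega), h1.2, h2.2,
        coeff_add, coeff_C_mul, coeff_eq_zero_of_natDegree_lt (p := h) (by omega), mul_zero,
        add_zero]
    rw [hybridChar, hnext, ← Finset.mul_prod_erase _ _ (Finset.mem_univ i₀), Int.cast_mul,
      mul_assoc, Finset.prod_congr rfl fun i hi => by
        rw [eval_add, eval_mul, eval_C, hhi i hi, mul_zero, add_zero]]
    simp
  have hp0 : (p : ℂ) ≠ 0 := Nat.cast_ne_zero.2 (Fact.out : p.Prime).ne_zero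
  have htot : (p : ℂ) * ∑ g ∈ monicFinset (ZMod p) n, hybridChar a u g = 0 := by
    calc (p : ℂ) * ∑ g ∈ monicFinset (ZMod p) n, hybridChar a u g
        = ∑ c : ZMod p, ∑ g ∈ monicFinset (ZMod p) n, hybridChar a u g := by
          simp [ZMod.card]
      _ = ∑ c : ZMod p, ∑ g ∈ monicFinset (ZMod p) n, hybridChar a u (g + C c * h) :=
          Finset.sum_congr rfl fun c _ => hshift c
      _ = 0 := by
          rw [Finset.sum_comm]
          refine Finset.sum_eq_zero fun g hg => ?_
          rw [Finset.sum_congr rfl fun c _ => hval g hg c, ← Finset.sum_mul, ← Int.cast_sum,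
            sum_quadraticChar_affine hp _ hh0]
          simp
  exact (mul_eq_zero.1 htot).resolve_left hp0

/-- Summing over the twist `u` gives `p` times the indicator of trace zero, which is exactly the
size of the fibres of `z ↦ z ^ p - z`. -/
theorem sum_sum_hybridChar_fieldPoly (hp : p ≠ 2) (a : Fin m → ZMod p) {L : Type*} [Field L]
    [Fintype L] [DecidableEq L] [Algebra (ZMod p) L] :
    ∑ u : ZMod p, ∑ x : L, hybridChar a u (fieldPoly (ZMod p) x)
      = ((∑ z : L, quadraticChar L
          ((∏ i, (C (algebraMap (ZMod p) L (a i)) - (X ^ p - X)) : L[X]).eval z) : ℤ) : ℂ) := by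
  have h1 := sum_comp_pow_sub (p := p) (fun x : L =>
    ((quadraticChar L (∏ i, (algebraMap (ZMod p) L (a i) - x)) : ℤ) : ℂ))
  rw [Int.cast_sum]
  simp only [eval_prod, eval_sub, eval_C, eval_pow, eval_X]
  rw [h1, Finset.sum_comm]
  refine Finset.sum_congr rfl fun x _ => ?_
  simp only [hybridChar, eval_fieldPoly, nextCoeff_fieldPoly, quadraticChar_norm hp]
  rw [← Finset.mul_sum, map_prod]
  congr 1
  rw [AddChar.sum_mulShift _ (ZMod.isPrimitive_stdAddChar p), ZMod.card]
  simp

/-- Weil's bound for a product of shifted quadratic characters twisted by an additive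
character. -/
theorem norm_sum_prod_quadraticChar_mul_stdAddChar_le (hp : p ≠ 2) {a : Fin m → ZMod p}
    (ha : Function.Injective a) (hm : 0 < m) (u : ZMod p) :
    ‖∑ x : ZMod p, ((∏ i, quadraticChar (ZMod p) (a i - x) : ℤ) : ℂ)
        * ZMod.stdAddChar (-(u * x))‖ ≤ m * √p := by
  classical
  set s : ZMod p → ℕ → ℂ := fun u r =>
    ∑ x : GaloisField p r, hybridChar a u (fieldPoly (ZMod p) x) with hs
  set c : ZMod p → ℕ → ℂ := fun u n => ∑ g ∈ monicFinset (ZMod p) n, hybridChar a u g with hc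
  have hω : ∀ u, ∃ ω : Fin m → ℂ, ∀ n, 1 ≤ n → s u n = -∑ i, ω i ^ n := fun u =>
    eq_neg_sum_pow_of_recurrence (c u) (s u) (sum_hybridChar_zero a u)
      (fun n hn => sum_hybridChar_eq_zero hp ha hm u hn)
      (fun n => mul_sum_monicFinset_eq _ (hybridChar_mul a u) n)
  choose ω hω using hω
  have hp0 : (0 : ℝ) < p := Nat.cast_pos.2 (Fact.out : p.Prime).pos
  -- The `ω` are squared because the quadratic bound is available only for fields of square order.
  -- The constant may depend on `p`, since only `n` varies.
  have hbound : ∀ n, 1 ≤ n → ‖∑ j : ZMod p × Fin m, (ω j.1 j.2 ^ 2) ^ n‖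
      ≤ (9 * (m * p) + 10) * (p : ℝ) ^ n := by
    intro n hn
    have e1 : ∑ j : ZMod p × Fin m, (ω j.1 j.2 ^ 2) ^ n = -∑ u, s u (2 * n) := by
      rw [Fintype.sum_prod_type, ← Finset.sum_neg_distrib]
      refine Finset.sum_congr rfl fun u _ => ?_
      rw [hω u (2 * n) (by omega), neg_neg]
      exact Finset.sum_congr rfl fun i _ => (pow_mul _ _ _).symm
    have hcard : Fintype.card (GaloisField p (2 * n)) = (p ^ n) ^ 2 := by
      rw [← Nat.card_eq_fintype_card, GaloisField.card p _ (by omega), ← pow_mul, mul_comm]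
    have hinj : Function.Injective fun i => algebraMap (ZMod p) (GaloisField p (2 * n)) (a i) :=
      (algebraMap (ZMod p) (GaloisField p (2 * n))).injective.comp ha
    have hdeg := natDegree_prod_C_sub_artinSchreier (p := p)
      (fun i => algebraMap (ZMod p) (GaloisField p (2 * n)) (a i))
    have hW := abs_sum_quadraticChar_eval_le hp
      (squarefree_prod_C_sub_artinSchreier (p := p) hinj)
      (by rw [hdeg]; exact Nat.mul_pos hm (Fact.out : p.Prime).pos) hcard
    rw [hdeg] at hW
    rw [e1, norm_neg]
    simp only [hs]
    rw [sum_sum_hybridChar_fieldPoly hp a, Complex.norm_intCast]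
    exact_mod_cast hW
  have hle := norm_le_of_norm_sum_pow_le (fun j : ZMod p × Fin m => ω j.1 j.2 ^ 2) hp0 hbound
  have hle' : ∀ i, ‖ω u i‖ ≤ √p := by
    intro i
    have := hle (u, i)
    rw [norm_pow] at this
    exact Real.le_sqrt_of_sq_le this
  have h1 : c u 1 = s u 1 := by
    have := mul_sum_monicFinset_eq _ (hybridChar_mul a u) 1
    simpa [hc, hs, sum_hybridChar_zero] using this
  rw [← sum_hybridChar_one]
  change ‖c u 1‖ ≤ _
  rw [h1, hω u 1 le_rfl, norm_neg]
  refine (norm_sum_le _ _).trans ?_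
  refine (Finset.sum_le_card_nsmul _ _ (√p) fun i _ => ?_).trans ?_
  · rw [pow_one]
    exact hle' i
  · simp

end HybridSums

/-! ### Parseval and bilinear forms with kernel `g (x + y)` -/

section Bilinear

variable {p : ℕ} [Fact p.Prime]

theorem sum_stdAddChar_mul (t : ZMod p) :
    ∑ u : ZMod p, (ZMod.stdAddChar (u * t) : ℂ) = if t = 0 then (p : ℂ) else 0 := by
  rw [AddChar.sum_mulShift _ (ZMod.isPrimitive_stdAddChar p), ZMod.card]
  simp

theorem sum_norm_sq_fourier (a : ZMod p → ℝ) :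
    ∑ u : ZMod p, ‖∑ x, (a x : ℂ) * ZMod.stdAddChar (u * x)‖ ^ 2 = p * ∑ x, a x ^ 2 := by
  have key : ∀ u : ZMod p, ((‖∑ x, (a x : ℂ) * ZMod.stdAddChar (u * x)‖ ^ 2 : ℝ) : ℂ)
      = ∑ x, ∑ y, (a x : ℂ) * a y * ZMod.stdAddChar (u * (x - y)) := by
    intro u
    rw [Complex.ofReal_pow, ← Complex.mul_conj', map_sum, Finset.sum_mul_sum]
    refine Finset.sum_congr rfl fun x _ => Finset.sum_congr rfl fun y _ => ?_
    rw [map_mul (starRingEnd ℂ), Complex.conj_ofReal, ← AddChar.map_neg_eq_conj, mul_sub, sub_eq_add_neg,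
      AddChar.map_add_eq_mul]
    ring
  have h : ((∑ u : ZMod p, ‖∑ x, (a x : ℂ) * ZMod.stdAddChar (u * x)‖ ^ 2 : ℝ) : ℂ)
      = ((p * ∑ x, a x ^ 2 : ℝ) : ℂ) := by
    rw [Complex.ofReal_sum, Finset.sum_congr rfl fun u _ => key u, Finset.sum_comm]
    push_cast
    rw [Finset.mul_sum]
    refine Finset.sum_congr rfl fun x _ => ?_
    rw [Finset.sum_comm]
    simp only [← Finset.mul_sum, sum_stdAddChar_mul, sub_eq_zero]
    simp only [mul_ite, mul_zero, Finset.sum_ite_eq, Finset.mem_univ, if_true]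
    ring
  exact_mod_cast h

/-- A bilinear form with kernel `g (x + y)` is controlled by the Fourier transform of `g`. -/
theorem abs_sum_sum_add_le {g a b : ZMod p → ℝ} {M : ℝ}
    (hg : ∀ u : ZMod p, ‖∑ x, (g x : ℂ) * ZMod.stdAddChar (-(u * x))‖ ≤ M)
    (ha : ∀ x, |a x| ≤ 1) (hb : ∀ x, |b x| ≤ 1) :
    |∑ x, ∑ y, g (x + y) * a x * b y| ≤ p * M := by
  have hp0 : (0 : ℝ) < p := Nat.cast_pos.2 (Fact.out : p.Prime).pos
  set G : ZMod p → ℂ := fun u => ∑ x, (g x : ℂ) * ZMod.stdAddChar (-(u * x)) with hG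
  set A : ZMod p → ℂ := fun u => ∑ x, (a x : ℂ) * ZMod.stdAddChar (u * x) with hA
  set B : ZMod p → ℂ := fun u => ∑ x, (b x : ℂ) * ZMod.stdAddChar (u * x) with hB
  have hinv : ∀ s : ZMod p, (p : ℂ) * g s = ∑ u, G u * ZMod.stdAddChar (u * s) := by
    intro s
    simp only [hG, Finset.sum_mul]
    rw [Finset.sum_comm]
    have : ∀ t : ZMod p, ∑ u : ZMod p,
        (g t : ℂ) * ZMod.stdAddChar (-(u * t)) * ZMod.stdAddChar (u * s)
        = g t * if s - t = 0 then (p : ℂ) else 0 := by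
      intro t
      rw [← sum_stdAddChar_mul, Finset.mul_sum]
      refine Finset.sum_congr rfl fun u _ => ?_
      rw [mul_assoc, ← AddChar.map_add_eq_mul]
      congr 2
      ring
    rw [Finset.sum_congr rfl fun t _ => this t]
    simp only [sub_eq_zero, mul_ite, mul_zero, Finset.sum_ite_eq, Finset.mem_univ, if_true]
    ring
  have hS : (p : ℂ) * ((∑ x, ∑ y, g (x + y) * a x * b y : ℝ) : ℂ) = ∑ u, G u * A u * B u := by
    push_cast
    have e : ∀ u, G u * A u * B u = ∑ x, ∑ y,
        G u * ZMod.stdAddChar (u * (x + y)) * a x * b y := by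
      intro u
      simp only [hA, hB]
      rw [mul_assoc, Finset.sum_mul_sum, Finset.mul_sum]
      refine Finset.sum_congr rfl fun x _ => ?_
      rw [Finset.mul_sum]
      refine Finset.sum_congr rfl fun y _ => ?_
      rw [mul_add, AddChar.map_add_eq_mul]
      ring
    rw [Finset.sum_congr rfl fun u _ => e u, Finset.mul_sum]
    conv_rhs => rw [Finset.sum_comm]
    refine Finset.sum_congr rfl fun x _ => ?_
    rw [Finset.mul_sum]
    conv_rhs => rw [Finset.sum_comm]
    refine Finset.sum_congr rfl fun y _ => ?_
    rw [← Finset.sum_mul, ← Finset.sum_mul, ← hinv]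
    ring
  have hM : 0 ≤ M := (norm_nonneg _).trans (hg 0)
  have hsq : ∀ c : ZMod p → ℝ, (∀ x, |c x| ≤ 1) → ∑ x, c x ^ 2 ≤ p := by
    intro c hc
    refine (Finset.sum_le_card_nsmul _ _ 1 fun x _ => ?_).trans ?_
    · exact (sq_le_one_iff_abs_le_one _).2 (hc x)
    · simp [ZMod.card]
  have hAB : ∑ u, ‖A u‖ * ‖B u‖ ≤ (p : ℝ) * p := by
    have h1 : ∑ u, ‖A u‖ * ‖B u‖ ≤ ∑ u, (‖A u‖ ^ 2 + ‖B u‖ ^ 2) / 2 :=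
      Finset.sum_le_sum fun u _ => by nlinarith [sq_nonneg (‖A u‖ - ‖B u‖)]
    rw [← Finset.sum_div, Finset.sum_add_distrib, sum_norm_sq_fourier, sum_norm_sq_fourier] at h1
    nlinarith [mul_le_mul_of_nonneg_left (hsq a ha) hp0.le,
      mul_le_mul_of_nonneg_left (hsq b hb) hp0.le]
  have hfin : (p : ℝ) * |∑ x, ∑ y, g (x + y) * a x * b y| ≤ p * (p * M) := by
    have h1 : (p : ℝ) * |∑ x, ∑ y, g (x + y) * a x * b y| = ‖∑ u, G u * A u * B u‖ := by
      rw [← hS, norm_mul, Complex.norm_natCast, Complex.norm_real, Real.norm_eq_abs]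
    rw [h1]
    calc ‖∑ u, G u * A u * B u‖ ≤ ∑ u, M * (‖A u‖ * ‖B u‖) := by
          refine (norm_sum_le _ _).trans (Finset.sum_le_sum fun u _ => ?_)
          rw [norm_mul, norm_mul, mul_assoc]
          exact mul_le_mul_of_nonneg_right (hg u) (by positivity)
      _ = M * ∑ u, ‖A u‖ * ‖B u‖ := by rw [Finset.mul_sum]
      _ ≤ M * (p * p) := mul_le_mul_of_nonneg_left hAB hM
      _ = p * (p * M) := by ring
  exact le_of_mul_le_mul_left hfin hp0

end Bilinear

/-! ### Products of shifted characters under differencing -/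

section Multilinear

variable {p : ℕ} [Fact p.Prime]

/-- The product of the quadratic characters of `a j - s`. -/
noncomputable def shiftedCharProd {m : ℕ} (a : Fin m → ZMod p) (s : ZMod p) : ℝ :=
  ((∏ j, quadraticChar (ZMod p) (a j - s) : ℤ) : ℝ)

theorem abs_quadraticChar_le_one (x : ZMod p) : |((quadraticChar (ZMod p) x : ℤ) : ℝ)| ≤ 1 := by
  by_cases h : x = 0
  · simp [h]
  · rcases quadraticChar_dichotomy h with h | h <;> simp [h]

theorem abs_shiftedCharProd_le_one {m : ℕ} (a : Fin m → ZMod p) (s : ZMod p) :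
    |shiftedCharProd a s| ≤ 1 := by
  rw [shiftedCharProd, Int.cast_prod, Finset.abs_prod]
  exact Finset.prod_le_one (fun _ _ => abs_nonneg _) fun j _ => abs_quadraticChar_le_one _

theorem shiftedCharProd_append {m n : ℕ} (a : Fin m → ZMod p) (b : Fin n → ZMod p) (s : ZMod p) :
    shiftedCharProd (Fin.append a b) s = shiftedCharProd a s * shiftedCharProd b s := by
  simp [shiftedCharProd, Fin.prod_univ_add]

theorem shiftedCharProd_add {m : ℕ} (a : Fin m → ZMod p) (x s : ZMod p) :
    shiftedCharProd a (x + s) = shiftedCharProd (fun j => a j - x) s := by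
  simp [shiftedCharProd, sub_sub]

/-- Distinct shifts are what the Weil bound needs. Differencing by `h` preserves distinctness unless
`h` is one of at most `m ^ 2` differences of the old shifts. -/
theorem injective_append_sub {m : ℕ} {a : Fin m → ZMod p} (ha : Function.Injective a)
    {x h : ZMod p} (hh : ∀ i j, h ≠ a j - a i) :
    Function.Injective (Fin.append (fun j => a j - x) fun j => a j - (x + h)) := by
  intro i j
  refine Fin.addCases (fun i => ?_) (fun i => ?_) i <;>
    refine Fin.addCases (fun j => ?_) (fun j => ?_) j <;>
    simp only [Fin.append_left, Fin.append_right] <;> intro e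
  · rw [ha (sub_left_injective e)]
  · exact absurd (by linear_combination e) (hh i j)
  · exact absurd (by linear_combination -e) (hh j i)
  · rw [ha (sub_left_injective e)]

theorem sum_fin_cons {α : Type*} [Fintype α] {n : ℕ} (F : (Fin (n + 1) → α) → ℝ) :
    ∑ x, F x = ∑ y : Fin n → α, ∑ x₀ : α, F (Fin.cons x₀ y) := by
  rw [Finset.sum_comm, ← Fintype.sum_prod_type']
  exact (Equiv.sum_comp (Fin.consEquiv fun _ => α) F).symm

theorem removeNth_succ_cons {α : Type*} {n : ℕ} (i : Fin (n + 1)) (x₀ : α) (y : Fin (n + 1) → α) :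
    i.succ.removeNth (Fin.cons x₀ y : Fin (n + 2) → α) = Fin.cons x₀ (i.removeNth y) := by
  funext j
  refine Fin.cases ?_ (fun j => ?_) j <;> simp [Fin.removeNth]

end Multilinear

/-! ### Cauchy–Schwarz induction for the multilinear sums -/

section Multilinear

theorem abs_multilinear_sum_two_le {p : ℕ} [Fact p.Prime] (hp : p ≠ 2) {m : ℕ} (hm : 0 < m)
    {a : Fin m → ZMod p} (ha : Function.Injective a) (f : Fin 2 → (Fin 1 → ZMod p) → ℝ)
    (hf : ∀ i y, |f i y| ≤ 1) :
    |∑ x : Fin 2 → ZMod p, shiftedCharProd a (∑ i, x i) * ∏ i, f i (i.removeNth x)|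
      ≤ p * (m * √p) := by
  have hg : ∀ u : ZMod p, ‖∑ x, (shiftedCharProd a x : ℂ) * ZMod.stdAddChar (-(u * x))‖
      ≤ m * √p := fun u => by
    simpa [shiftedCharProd] using norm_sum_prod_quadraticChar_mul_stdAddChar_le hp ha hm u
  have h := abs_sum_sum_add_le hg (a := fun x => f 1 fun _ => x) (b := fun y => f 0 fun _ => y)
    (fun _ => hf _ _) fun _ => hf _ _
  convert h using 2
  rw [sum_fin_cons, Finset.sum_comm]
  refine Finset.sum_congr rfl fun x _ => ?_
  rw [← Equiv.sum_comp (Equiv.funUnique (Fin 1) (ZMod p)).symm]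
  refine Finset.sum_congr rfl fun y _ => ?_
  have e0 : (0 : Fin 2).removeNth (Fin.cons x fun _ => y : Fin 2 → ZMod p) = fun _ => y := by
    funext j
    fin_cases j
    rfl
  have e1 : (1 : Fin 2).removeNth (Fin.cons x fun _ => y : Fin 2 → ZMod p) = fun _ => x := by
    funext j
    fin_cases j
    rfl
  have e2 : (Equiv.funUnique (Fin 1) (ZMod p)).symm y = fun _ => y := rfl
  rw [e2, Fin.sum_univ_two, Fin.prod_univ_two, e0, e1]
  simp only [Fin.cons_zero, Fin.cons_one]
  ring

theorem abs_multilinear_sum_le_card {p : ℕ} [Fact p.Prime] {m n : ℕ} (a : Fin m → ZMod p)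
    (f : Fin (n + 1) → (Fin n → ZMod p) → ℝ) (hf : ∀ i y, |f i y| ≤ 1) :
    |∑ x : Fin (n + 1) → ZMod p, shiftedCharProd a (∑ i, x i) * ∏ i, f i (i.removeNth x)|
      ≤ (p : ℝ) ^ (n + 1) := by
  refine (Finset.abs_sum_le_sum_abs _ _).trans
    ((Finset.sum_le_card_nsmul _ _ 1 fun x _ => ?_).trans ?_)
  · rw [abs_mul, Finset.abs_prod]
    exact mul_le_one₀ (abs_shiftedCharProd_le_one _ _) (Finset.prod_nonneg fun _ _ => abs_nonneg _)
      (Finset.prod_le_one (fun _ _ => abs_nonneg _) fun _ _ => hf _ _)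
  · simp [ZMod.card]

/-- One application of the Cauchy–Schwarz inequality removes the function that does not depend on
the first variable. -/
theorem sq_multilinear_sum_le {p : ℕ} [Fact p.Prime] {m n : ℕ} (a : Fin m → ZMod p)
    (f : Fin (n + 2) → (Fin (n + 1) → ZMod p) → ℝ) (hf : ∀ i y, |f i y| ≤ 1) :
    (∑ x : Fin (n + 2) → ZMod p, shiftedCharProd a (∑ i, x i) * ∏ i, f i (i.removeNth x)) ^ 2
      ≤ (p : ℝ) ^ (n + 1) * ∑ h : ZMod p, ∑ x₀ : ZMod p, ∑ y : Fin (n + 1) → ZMod p,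
          shiftedCharProd (Fin.append (fun j => a j - x₀) fun j => a j - (x₀ + h)) (∑ i, y i) *
          ∏ i : Fin (n + 1), (f i.succ (Fin.cons x₀ (i.removeNth y)) *
            f i.succ (Fin.cons (x₀ + h) (i.removeNth y))) := by
  set H : ZMod p → (Fin (n + 1) → ZMod p) → ℝ := fun x₀ y =>
    shiftedCharProd a (x₀ + ∑ i, y i) * ∏ i : Fin (n + 1), f i.succ (Fin.cons x₀ (i.removeNth y))
    with hH
  have e1 : ∑ x : Fin (n + 2) → ZMod p, shiftedCharProd a (∑ i, x i) * ∏ i, f i (i.removeNth x)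
      = ∑ y, f 0 y * ∑ x₀, H x₀ y := by
    rw [sum_fin_cons]
    refine Finset.sum_congr rfl fun y _ => ?_
    rw [Finset.mul_sum]
    refine Finset.sum_congr rfl fun x₀ _ => ?_
    rw [Fin.sum_univ_succ, Fin.prod_univ_succ]
    simp only [hH, removeNth_succ_cons, Fin.cons_zero, Fin.cons_succ, Fin.removeNth_zero,
      Fin.tail_cons]
    ring
  have e2 : ∑ h : ZMod p, ∑ x₀ : ZMod p, ∑ y : Fin (n + 1) → ZMod p,
          shiftedCharProd (Fin.append (fun j => a j - x₀) fun j => a j - (x₀ + h)) (∑ i, y i) *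
          ∏ i : Fin (n + 1), (f i.succ (Fin.cons x₀ (i.removeNth y)) *
            f i.succ (Fin.cons (x₀ + h) (i.removeNth y)))
      = ∑ y, (∑ x₀, H x₀ y) ^ 2 := by
    -- Expand the square and write the second variable as `x₀ + h`.
    have : ∀ y, (∑ x₀, H x₀ y) ^ 2 = ∑ h, ∑ x₀, H x₀ y * H (x₀ + h) y := by
      intro y
      rw [sq, Finset.sum_mul_sum, Finset.sum_comm]
      conv_rhs => rw [Finset.sum_comm]
      rw [Finset.sum_comm]
      refine Finset.sum_congr rfl fun x₀ _ => ?_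
      exact (Equiv.sum_comp (Equiv.addLeft x₀) fun z => H x₀ y * H z y).symm
    rw [Finset.sum_congr rfl fun y _ => this y]
    conv_rhs => rw [Finset.sum_comm]
    refine Finset.sum_congr rfl fun h _ => ?_
    conv_rhs => rw [Finset.sum_comm]
    refine Finset.sum_congr rfl fun x₀ _ => Finset.sum_congr rfl fun y _ => ?_
    simp only [hH, shiftedCharProd_append, shiftedCharProd_add, Finset.prod_mul_distrib]
    ring
  rw [e1, e2]
  refine (Finset.sum_mul_sq_le_sq_mul_sq _ _ _).trans ?_
  refine mul_le_mul_of_nonneg_right ?_ (Finset.sum_nonneg fun _ _ => sq_nonneg _)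
  refine (Finset.sum_le_card_nsmul _ _ 1 fun y _ => ?_).trans ?_
  · exact (sq_le_one_iff_abs_le_one _).2 (hf 0 y)
  · simp [ZMod.card]

theorem card_image_sub_le {p m : ℕ} (a : Fin m → ZMod p) [DecidableEq (ZMod p)] :
    (Finset.univ.image fun ij : Fin m × Fin m => a ij.2 - a ij.1).card ≤ m ^ 2 :=
  Finset.card_image_le.trans (by simp [sq])

/-- The quadratic character of a sum does not correlate with products of functions each of which
misses one of the variables. -/
theorem exists_abs_multilinear_sum_le (k : ℕ) : ∀ m : ℕ, 0 < m → ∃ C : ℝ, 0 ≤ C ∧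
    ∀ (p : ℕ) [Fact p.Prime], p ≠ 2 → ∀ a : Fin m → ZMod p, Function.Injective a →
      ∀ f : Fin (k + 2) → (Fin (k + 1) → ZMod p) → ℝ, (∀ i y, |f i y| ≤ 1) →
        |∑ x : Fin (k + 2) → ZMod p, shiftedCharProd a (∑ i, x i) * ∏ i, f i (i.removeNth x)|
          ≤ C * (p : ℝ) ^ ((k + 2 : ℝ) - (2 : ℝ) ^ (-(k + 1 : ℝ))) := by
  induction k with
  | zero =>
    intro m hm
    refine ⟨m, Nat.cast_nonneg _, fun p _ hp a ha f hf => ?_⟩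
    refine (abs_multilinear_sum_two_le hp hm ha f hf).trans_eq ?_
    have hp0 : (0 : ℝ) < p := Nat.cast_pos.2 (Fact.out : p.Prime).pos
    have : (((0 : ℕ) : ℝ) + 2) - (2 : ℝ) ^ (-(((0 : ℕ) : ℝ) + 1)) = 1 + 1 / 2 := by
      rw [Nat.cast_zero, zero_add, zero_add, Real.rpow_neg_one]
      norm_num
    rw [this, Real.rpow_add hp0, Real.rpow_one, Real.sqrt_eq_rpow]
    ring
  | succ k ih =>
    intro m hm
    -- Differencing doubles the number of shifts, which is why the induction keeps `m` arbitrary.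
    obtain ⟨C, hC, hbound⟩ := ih (m + m) (by omega)
    refine ⟨√(m ^ 2 + C), Real.sqrt_nonneg _, fun p _ hp a ha f hf => ?_⟩
    classical
    have hp1 : (1 : ℝ) ≤ p := Nat.one_le_cast.2 (Fact.out : p.Prime).one_le
    have hp0 : (0 : ℝ) < p := by linarith
    set δ : ℝ := (2 : ℝ) ^ (-(k + 1 : ℝ)) with hδ
    have hδ1 : δ ≤ 1 := Real.rpow_le_one_of_one_le_of_nonpos (by norm_num) (by
      have : (0 : ℝ) ≤ k := Nat.cast_nonneg k
      linarith)
    have hδ2 : (2 : ℝ) ^ (-(((k + 1 : ℕ) : ℝ) + 1)) = δ / 2 := by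
      rw [hδ, show (-(((k + 1 : ℕ) : ℝ) + 1)) = -(k + 1 : ℝ) + (-1) by push_cast; ring,
        Real.rpow_add (by norm_num), Real.rpow_neg_one]
      ring
    set bad := Finset.univ.image fun ij : Fin m × Fin m => a ij.2 - a ij.1 with hbad
    set T : ZMod p → ZMod p → ℝ := fun h x₀ => ∑ y : Fin (k + 2) → ZMod p,
          shiftedCharProd (Fin.append (fun j => a j - x₀) fun j => a j - (x₀ + h)) (∑ i, y i) *
          ∏ i : Fin (k + 2), (f i.succ (Fin.cons x₀ (i.removeNth y)) *
            f i.succ (Fin.cons (x₀ + h) (i.removeNth y))) with hT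
    have hff : ∀ (h x₀ : ZMod p) (i : Fin (k + 2)) (w : Fin (k + 1) → ZMod p),
        |f i.succ (Fin.cons x₀ w) * f i.succ (Fin.cons (x₀ + h) w)| ≤ 1 := by
      intro h x₀ i w
      rw [abs_mul]
      exact mul_le_one₀ (hf _ _) (abs_nonneg _) (hf _ _)
    have hTbad : ∀ h x₀, T h x₀ ≤ (p : ℝ) ^ (k + 2) := fun h x₀ =>
      (le_abs_self _).trans (abs_multilinear_sum_le_card _
        (fun i w => f i.succ (Fin.cons x₀ w) * f i.succ (Fin.cons (x₀ + h) w)) (hff h x₀))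
    have hTgood : ∀ h, h ∉ bad → ∀ x₀, T h x₀ ≤ C * (p : ℝ) ^ ((k + 2 : ℝ) - δ) := by
      intro h hh x₀
      refine (le_abs_self _).trans (hbound p hp _ (injective_append_sub ha ?_)
        (fun i w => f i.succ (Fin.cons x₀ w) * f i.succ (Fin.cons (x₀ + h) w)) (hff h x₀))
      intro i j e
      exact hh (Finset.mem_image.2 ⟨(i, j), Finset.mem_univ _, e.symm⟩)
    have hrow : ∀ h, ∑ x₀, T h x₀ ≤ (if h ∈ bad then (p : ℝ) ^ (k + 3) else 0)
        + C * (p : ℝ) ^ ((k + 3 : ℝ) - δ) := by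
      intro h
      have hpos : 0 ≤ C * (p : ℝ) ^ ((k + 3 : ℝ) - δ) := by positivity
      split_ifs with hh
      · refine (Finset.sum_le_card_nsmul _ _ _ fun x₀ _ => hTbad h x₀).trans ?_
        rw [Finset.card_univ, ZMod.card, nsmul_eq_mul, ← pow_succ']
        linarith
      · refine (Finset.sum_le_card_nsmul _ _ _ fun x₀ _ => hTgood h hh x₀).trans_eq ?_
        rw [Finset.card_univ, ZMod.card, nsmul_eq_mul, zero_add,
          show (k + 3 : ℝ) - δ = 1 + ((k + 2 : ℝ) - δ) by ring, Real.rpow_add hp0, Real.rpow_one]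
        ring
    -- The at most `m ^ 2` bad `h`, bounded trivially, cost `m ^ 2 * p ^ (k + 3)`, which is absorbed
    -- because `δ ≤ 1`. After the square root the saving is `δ / 2`.
    have hsum : ∑ h, ∑ x₀, T h x₀ ≤ (m ^ 2 + C) * (p : ℝ) ^ ((k + 4 : ℝ) - δ) := by
      refine (Finset.sum_le_sum fun h _ => hrow h).trans ?_
      rw [Finset.sum_add_distrib, ← Finset.sum_filter, Finset.filter_mem_eq_inter, Finset.univ_inter,
        Finset.sum_const, Finset.sum_const, Finset.card_univ, ZMod.card, nsmul_eq_mul, nsmul_eq_mul,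
        add_mul]
      refine add_le_add ?_ (le_of_eq ?_)
      · have h1 : (bad.card : ℝ) ≤ (m : ℝ) ^ 2 := by exact_mod_cast card_image_sub_le a
        refine mul_le_mul h1 ?_ (by positivity) (by positivity)
        rw [← Real.rpow_natCast]
        refine Real.rpow_le_rpow_of_exponent_le hp1 ?_
        push_cast
        linarith
      · rw [show (k + 4 : ℝ) - δ = 1 + ((k + 3 : ℝ) - δ) by ring, Real.rpow_add hp0, Real.rpow_one]
        ring
    have hsq := sq_multilinear_sum_le a f hf
    have hfinal := hsq.trans (mul_le_mul_of_nonneg_left hsum (by positivity))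
    refine abs_le_of_sq_le_sq (hfinal.trans_eq ?_) (by positivity)
    rw [mul_pow, Real.sq_sqrt (by positivity), hδ2, ← Real.rpow_mul_natCast hp0.le,
      ← Real.rpow_natCast (p : ℝ) (k + 1 + 1), mul_left_comm, ← Real.rpow_add hp0]
    congr 2
    push_cast
    ring

end Multilinear

/-! ### Signs of cochains and ordered tuples of vertices -/

namespace SimplexCochain

section Sign

/-- The nontrivial character of `ℤ/2`. -/
noncomputable def sign (t : ZMod 2) : ℝ := if t = 0 then 1 else -1

theorem sign_add (s t : ZMod 2) : sign (s + t) = sign s * sign t := by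
  have h : (1 : ZMod 2) + 1 = 0 := rfl
  have h01 : ∀ t : ZMod 2, t = 0 ∨ t = 1 := by decide
  rcases h01 s with rfl | rfl <;> rcases h01 t with rfl | rfl <;> simp [sign, h]

theorem sign_sum {ι : Type*} (s : Finset ι) (f : ι → ZMod 2) :
    sign (∑ i ∈ s, f i) = ∏ i ∈ s, sign (f i) := by
  classical
  induction s using Finset.induction_on with
  | empty => simp [sign]
  | insert a s ha ih => rw [Finset.sum_insert ha, Finset.prod_insert ha, sign_add, ih]

theorem abs_sign (t : ZMod 2) : |sign t| = 1 := by
  unfold sign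
  split_ifs <;> simp

end Sign

section Ordered

variable {V : Type*} [DecidableEq V]

theorem norm_eq_sum_sign [Fintype V] {n : ℕ} (φ : Cochain V n) :
    (norm φ : ℝ) = (1 / 2) * ((Fintype.card V).choose n : ℝ) - (1 / 2) * ∑ σ, sign (φ σ) := by
  have h1 : ((Fintype.card V).choose n : ℝ) = ∑ _σ : Face V n, (1 : ℝ) := by
    rw [Finset.sum_const, Finset.card_univ, Fintype.card_finset_len]
    simp
  rw [h1, norm, Finset.card_filter, Nat.cast_sum, Finset.mul_sum, Finset.mul_sum,
    ← Finset.sum_sub_distrib]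
  refine Finset.sum_congr rfl fun σ _ => ?_
  by_cases h : φ σ = 0 <;> simp [sign, h]
  norm_num

/-- The face spanned by an injective tuple of vertices. -/
def ofInjective {n : ℕ} (x : Fin n → V) (hx : Function.Injective x) : Face V n :=
  ⟨Finset.univ.image x, by rw [Finset.card_image_of_injective _ hx, Finset.card_fin]⟩

theorem card_filter_ofInjective_eq [Fintype V] {n : ℕ} (σ : Face V n) :
    Fintype.card {x : {x : Fin n → V // Function.Injective x} // ofInjective x.1 x.2 = σ}
      = n.factorial := by
  let e₀ : Fin n ≃ σ.1 := (σ.1.equivFinOfCardEq σ.2).symm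
  have himg : ∀ e : Fin n ≃ σ.1, Finset.univ.image (fun i => (e i : V)) = σ.1 := by
    intro e
    ext v
    simp only [Finset.mem_image, Finset.mem_univ, true_and]
    constructor
    · rintro ⟨i, rfl⟩
      exact (e i).2
    · intro hv
      exact ⟨e.symm ⟨v, hv⟩, by simp⟩
  let Φ : (Fin n ≃ σ.1) →
      {x : {x : Fin n → V // Function.Injective x} // ofInjective x.1 x.2 = σ} :=
    fun e => ⟨⟨fun i => (e i : V), Subtype.val_injective.comp e.injective⟩,
      Subtype.ext (himg e)⟩
  have hΦ : Function.Bijective Φ := by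
    constructor
    · intro e e' h
      ext i
      exact congrFun (congrArg (fun y => y.1.1) h) i
    · rintro ⟨⟨x, hx⟩, hσ⟩
      have hmem : ∀ i, x i ∈ σ.1 := fun i => by
        rw [← hσ]
        exact Finset.mem_image_of_mem _ (Finset.mem_univ i)
      have hinj : Function.Injective fun i => (⟨x i, hmem i⟩ : σ.1) := fun i j h =>
        hx (congrArg Subtype.val h)
      have hbij := (Fintype.bijective_iff_injective_and_card _).2
        ⟨hinj, by simp [σ.2]⟩
      exact ⟨Equiv.ofBijective _ hbij, rfl⟩
  rw [← Fintype.card_of_bijective hΦ, Fintype.card_equiv e₀, Fintype.card_fin]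

open Classical in
theorem sum_ofInjective [Fintype V] {n : ℕ} (F : Face V n → ℝ) :
    ∑ x : Fin n → V, (if hx : Function.Injective x then F (ofInjective x hx) else 0)
      = n.factorial * ∑ σ, F σ := by
  have h1 : ∑ x : Fin n → V, (if hx : Function.Injective x then F (ofInjective x hx) else 0)
      = ∑ x : {x : Fin n → V // Function.Injective x}, F (ofInjective x.1 x.2) := by
    rw [← Finset.sum_filter_add_sum_filter_not Finset.univ
      (fun x : Fin n → V => Function.Injective x)]
    rw [Finset.sum_eq_zero (s := Finset.univ.filter fun x : Fin n → V => ¬ Function.Injective x)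
      (fun x hx => dif_neg (Finset.mem_filter.1 hx).2), add_zero]
    rw [Finset.sum_subtype (p := fun x : Fin n → V => Function.Injective x) _
      (fun x => by simp)]
    exact Finset.sum_congr rfl fun x _ => dif_pos x.2
  rw [h1, ← Finset.sum_fiberwise (g := fun x : {x : Fin n → V // Function.Injective x} =>
    ofInjective x.1 x.2), Finset.mul_sum]
  refine Finset.sum_congr rfl fun σ _ => ?_
  rw [Finset.sum_congr rfl (g := fun _ => F σ), Finset.sum_const, nsmul_eq_mul,
    ← card_filter_ofInjective_eq σ, Fintype.card_subtype]
  intro x hx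
  rw [(Finset.mem_filter.1 hx).2]

open Classical in
/-- The sign of a cochain as a function of tuples of vertices. -/
noncomputable def tupleSign {n : ℕ} (ψ : Cochain V n) (y : Fin n → V) : ℝ :=
  -- The default `1` only has to be bounded by `1`: non-injective tuples enter the error term.
  if hy : Function.Injective y then sign (ψ (ofInjective y hy)) else 1

theorem abs_tupleSign_le_one {n : ℕ} (ψ : Cochain V n) (y : Fin n → V) :
    |tupleSign ψ y| ≤ 1 := by
  unfold tupleSign
  split_ifs
  · exact (abs_sign _).le
  · simp

theorem sign_coboundary_ofInjective {n : ℕ} (ψ : Cochain V n) {x : Fin (n + 1) → V}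
    (hx : Function.Injective x) :
    sign (coboundary ψ (ofInjective x hx)) = ∏ i : Fin (n + 1), tupleSign ψ (i.removeNth x) := by
  rw [coboundary, sign_sum]
  symm
  have hmem : ∀ i, x i ∈ (ofInjective x hx).1 := fun i =>
    Finset.mem_image_of_mem _ (Finset.mem_univ i)
  refine Finset.prod_bij (fun (i : Fin (n + 1)) _ => ⟨x i, hmem i⟩) ?_ ?_ ?_ ?_
  · intro i _
    exact Finset.mem_attach _ _
  · intro i _ j _ h
    exact hx (congrArg Subtype.val h)
  · rintro ⟨v, hv⟩ _
    obtain ⟨i, -, rfl⟩ := Finset.mem_image.1 hv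
    exact ⟨i, Finset.mem_univ _, rfl⟩
  · intro i _
    have hinj : Function.Injective (i.removeNth x) := hx.comp Fin.succAbove_right_injective
    rw [tupleSign, dif_pos hinj]
    congr 2
    refine Subtype.ext ?_
    ext v
    simp only [ofInjective, Face.erase, Finset.mem_image, Finset.mem_univ, true_and,
      Finset.mem_erase]
    constructor
    · rintro ⟨j, rfl⟩
      exact ⟨fun h => Fin.succAbove_ne i j (hx h), i.succAbove j, rfl⟩
    · rintro ⟨hne, j, rfl⟩
      obtain ⟨l, rfl⟩ := Fin.exists_succAbove_eq (x := j) (y := i) (fun h => hne (by rw [h]))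
      exact ⟨l, rfl⟩

end Ordered

/-! ### The sign sum of the Paley cochain -/

section Paley

variable {p : ℕ} [Fact p.Prime]

/-- The correction is needed at zero sums, where `χ = 0` but the cochain is `0` and has sign `1`. -/
theorem sign_paley {k : ℕ} (σ : Face (ZMod p) (k + 1)) :
    sign (paley p k σ) = -((quadraticChar (ZMod p) (∑ x ∈ σ.1, x) : ℤ) : ℝ)
      + if ∑ x ∈ σ.1, x = 0 then 1 else 0 := by
  unfold paley sign
  by_cases h : ∑ x ∈ σ.1, x = 0
  · simp [h]
  · have hne : (-1 : ℤ) ≠ 1 := by norm_num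
    rcases quadraticChar_dichotomy h with h' | h' <;> simp [h, h', hne]

theorem sum_ite_sum_eq_zero (k : ℕ) :
    ∑ x : Fin (k + 1) → ZMod p, (if ∑ i, x i = 0 then (1 : ℝ) else 0) = (p : ℝ) ^ k := by
  rw [sum_fin_cons]
  have : ∀ y : Fin k → ZMod p, ∑ x₀ : ZMod p,
      (if ∑ i, (Fin.cons x₀ y : Fin (k + 1) → ZMod p) i = 0 then (1 : ℝ) else 0) = 1 := by
    intro y
    simp [Fin.sum_univ_succ, add_eq_zero_iff_eq_neg]
  rw [Finset.sum_congr rfl fun y _ => this y]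
  simp [ZMod.card]

theorem sub_pow_le_factorial_mul_choose {p n : ℕ} (hn : n ≤ p) :
    ((p : ℝ) - (n - 1)) ^ n ≤ n.factorial * (p.choose n : ℝ) := by
  have h := Nat.pow_sub_le_descFactorial p n
  rw [Nat.descFactorial_eq_factorial_mul_choose] at h
  have h2 : (((p + 1 - n : ℕ) : ℝ)) ^ n ≤ n.factorial * (p.choose n : ℝ) := by exact_mod_cast h
  rw [Nat.cast_sub (by omega)] at h2
  convert h2 using 2
  push_cast
  ring

open Classical in
theorem sum_not_injective_le {k : ℕ} (hk : k < p) :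
    ∑ x : Fin (k + 1) → ZMod p, (if Function.Injective x then (0 : ℝ) else 1)
      ≤ (k + 1) ^ 2 * (p : ℝ) ^ k := by
  have hp0 : (0 : ℝ) < p := Nat.cast_pos.2 (Fact.out : p.Prime).pos
  have h1 := sum_ofInjective (V := ZMod p) (n := k + 1) fun _ => 1
  have h2 : ∑ σ : Face (ZMod p) (k + 1), (1 : ℝ) = (p.choose (k + 1) : ℝ) := by
    rw [Finset.sum_const, Finset.card_univ, Fintype.card_finset_len, ZMod.card]
    simp
  have h3 : ∑ x : Fin (k + 1) → ZMod p, (if Function.Injective x then (0 : ℝ) else 1)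
      = (p : ℝ) ^ (k + 1) - (k + 1).factorial * (p.choose (k + 1) : ℝ) := by
    have e : (p : ℝ) ^ (k + 1) = ∑ _x : Fin (k + 1) → ZMod p, (1 : ℝ) := by simp [ZMod.card]
    rw [← h2, ← h1, e, ← Finset.sum_sub_distrib]
    refine Finset.sum_congr rfl fun x _ => ?_
    split_ifs <;> simp
  have h4 := sub_pow_le_factorial_mul_choose (p := p) (n := k + 1) hk
  have hkp : (k : ℝ) / p ≤ 1 := by
    rw [div_le_one hp0]
    exact_mod_cast hk.le
  -- Bernoulli's inequality, applied to `(1 - k / p) ^ (k + 1)`.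
  have h5 := one_add_mul_le_pow (a := -((k : ℝ) / p)) (by linarith) (k + 1)
  have h6 : ((p : ℝ) - ((k + 1 : ℕ) - 1)) ^ (k + 1)
      = (p : ℝ) ^ (k + 1) * (1 + -((k : ℝ) / p)) ^ (k + 1) := by
    rw [← mul_pow]
    congr 1
    push_cast
    field_simp
    ring
  rw [h6] at h4
  have h7 := mul_le_mul_of_nonneg_left h5 (by positivity : 0 ≤ (p : ℝ) ^ (k + 1))
  have h8 : (p : ℝ) ^ (k + 1) * (1 + ((k + 1 : ℕ) : ℝ) * -((k : ℝ) / p))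
      = (p : ℝ) ^ (k + 1) - (k + 1) * k * (p : ℝ) ^ k := by
    push_cast
    field_simp
    ring
  rw [h8] at h7
  rw [h3]
  have h9 : (0 : ℝ) ≤ (k + 1) * (p : ℝ) ^ k := by positivity
  nlinarith

/-- From `p ≤ (k + 1) * (p - k)`, valid for every `p > k`. This makes the final constant uniform,
small primes included. -/
theorem pow_le_mul_choose {p k : ℕ} (hk : k < p) :
    (p : ℝ) ^ (k + 1) ≤ (k + 1) ^ (k + 1) * ((k + 1).factorial * (p.choose (k + 1) : ℝ)) := by
  have h4 := sub_pow_le_factorial_mul_choose (p := p) (n := k + 1) hk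
  refine le_trans ?_ (mul_le_mul_of_nonneg_left h4 (by positivity))
  rw [← mul_pow]
  have hk' : (k : ℝ) + 1 ≤ p := by exact_mod_cast hk
  have hk0 : (0 : ℝ) ≤ k := Nat.cast_nonneg k
  refine pow_le_pow_left₀ (Nat.cast_nonneg _) ?_ _
  push_cast
  nlinarith

theorem exists_sum_sign_le (k : ℕ) : ∃ C : ℝ, ∀ (p : ℕ) [Fact p.Prime], p ≠ 2 → k + 1 < p →
    ∀ ψ : Cochain (ZMod p) (k + 1),
      ∑ σ, sign ((paley p (k + 1) + coboundary ψ) σ)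
        ≤ (p.choose (k + 2) : ℝ) * (C * (p : ℝ) ^ (-((2 : ℝ) ^ (-(k + 1 : ℝ))))) := by
  classical
  obtain ⟨C, hC, hbound⟩ := exists_abs_multilinear_sum_le k 1 one_pos
  refine ⟨(C + 1 + (k + 2) ^ 2) * (k + 2) ^ (k + 2), fun p _ hp hk ψ => ?_⟩
  have hp1 : (1 : ℝ) ≤ p := Nat.one_le_cast.2 (Fact.out : p.Prime).one_le
  have hp0 : (0 : ℝ) < p := by linarith
  set δ : ℝ := (2 : ℝ) ^ (-(k + 1 : ℝ)) with hδ
  have hδ1 : δ ≤ 1 := Real.rpow_le_one_of_one_le_of_nonpos (by norm_num) (by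
    have : (0 : ℝ) ≤ k := Nat.cast_nonneg k
    linarith)
  set P : (Fin (k + 2) → ZMod p) → ℝ := fun x =>
    ∏ i : Fin (k + 2), tupleSign ψ (i.removeNth x) with hP
  set χ : (Fin (k + 2) → ZMod p) → ℝ := fun x =>
    ((quadraticChar (ZMod p) (∑ i, x i) : ℤ) : ℝ) with hχ
  have hPle : ∀ x, |P x| ≤ 1 := fun x => by
    rw [hP, Finset.abs_prod]
    exact Finset.prod_le_one (fun _ _ => abs_nonneg _) fun i _ => abs_tupleSign_le_one _ _
  have hall : |∑ x, χ x * P x| ≤ C * (p : ℝ) ^ ((k + 2 : ℝ) - δ) := by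
    have h1 := hbound p hp (fun _ => 0) (Function.injective_of_subsingleton _)
      (fun _ => tupleSign ψ) fun _ _ => abs_tupleSign_le_one _ _
    -- The kernel with the single shift `0` is `χ(-s)`, which is `χ(s)` up to the sign `χ(-1)`.
    have h2 : ∑ x : Fin (k + 2) → ZMod p, shiftedCharProd (fun _ : Fin 1 => (0 : ZMod p)) (∑ i, x i)
        * ∏ i : Fin (k + 2), tupleSign ψ (i.removeNth x)
        = ((quadraticChar (ZMod p) (-1) : ℤ) : ℝ) * ∑ x, χ x * P x := by
      rw [Finset.mul_sum]
      refine Finset.sum_congr rfl fun x _ => ?_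
      have : quadraticChar (ZMod p) (0 - ∑ i, x i)
          = quadraticChar (ZMod p) (-1) * quadraticChar (ZMod p) (∑ i, x i) := by
        rw [← map_mul]
        congr 1
        ring
      simp only [shiftedCharProd, Finset.univ_unique, Finset.prod_singleton, this, hχ, hP]
      push_cast
      ring
    have h3 : |((quadraticChar (ZMod p) (-1) : ℤ) : ℝ)| = 1 := by
      rcases quadraticChar_dichotomy (neg_ne_zero.2 (one_ne_zero (α := ZMod p))) with h | h <;>
        simp [h]
    rwa [h2, abs_mul, h3, one_mul] at h1
  -- The character sum is completed to all tuples, with an error of at most `1` at each zero-sum or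
  -- non-injective tuple.
  have hpoint : ∀ x : Fin (k + 2) → ZMod p,
      (if hx : Function.Injective x then
        sign ((paley p (k + 1) + coboundary ψ) (ofInjective x hx)) else 0)
      ≤ -(χ x * P x) + (if ∑ i, x i = 0 then 1 else 0)
        + (if Function.Injective x then 0 else 1) := by
    intro x
    have hχle : |χ x| ≤ 1 := abs_quadraticChar_le_one _
    by_cases hx : Function.Injective x
    · have hsum : ∑ v ∈ (ofInjective x hx).1, v = ∑ i, x i := by
        rw [ofInjective, Finset.sum_image fun i _ j _ h => hx h]
      rw [dif_pos hx, if_pos hx, Pi.add_apply, sign_add, sign_coboundary_ofInjective, sign_paley,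
        hsum, add_zero, add_mul, neg_mul]
      refine add_le_add_right ?_ _
      split_ifs
      · rw [one_mul]
        exact (abs_le.1 (hPle x)).2
      · rw [zero_mul]
    · rw [dif_neg hx, if_neg hx]
      have h2 : |χ x * P x| ≤ 1 := by
        rw [abs_mul]
        exact mul_le_one₀ hχle (abs_nonneg _) (hPle x)
      have h3 := (abs_le.1 h2).2
      split_ifs <;> linarith
  have hordered := sum_ofInjective fun σ => sign ((paley p (k + 1) + coboundary ψ) σ)
  have hle := Finset.sum_le_sum fun x (_ : x ∈ Finset.univ) => hpoint x
  rw [hordered, Finset.sum_add_distrib, Finset.sum_add_distrib, Finset.sum_neg_distrib,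
    sum_ite_sum_eq_zero] at hle
  have hni := sum_not_injective_le (p := p) (k := k + 1) hk
  have hpow : (p : ℝ) ^ (k + 1) ≤ (p : ℝ) ^ ((k + 2 : ℝ) - δ) := by
    rw [← Real.rpow_natCast]
    refine Real.rpow_le_rpow_of_exponent_le hp1 ?_
    push_cast
    linarith
  have hsplit : (p : ℝ) ^ ((k + 2 : ℝ) - δ) = (p : ℝ) ^ (k + 2) * (p : ℝ) ^ (-δ) := by
    rw [sub_eq_add_neg, Real.rpow_add hp0, ← Real.rpow_natCast]
    push_cast
    rfl
  have hchoose := pow_le_mul_choose (p := p) (k := k + 1) hk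
  have hneg := (abs_le.1 hall).1
  push_cast at hni hchoose
  rw [show (k : ℝ) + 1 + 1 = k + 2 by ring] at hni hchoose
  set E := (p : ℝ) ^ ((k + 2 : ℝ) - δ) with hE
  have hfac : (0 : ℝ) < (k + 2).factorial := by exact_mod_cast Nat.factorial_pos _
  have h1 : ((k + 2).factorial : ℝ) * ∑ σ, sign ((paley p (k + 1) + coboundary ψ) σ)
      ≤ (C + 1 + (k + 2) ^ 2) * E := by
    have h2 := mul_le_mul_of_nonneg_left hpow (by positivity : (0 : ℝ) ≤ (k + 2) ^ 2)
    linarith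
  have h2 : E ≤ ((k + 2) ^ (k + 2) * ((k + 2).factorial * (p.choose (k + 2) : ℝ)))
      * (p : ℝ) ^ (-δ) := by
    rw [hsplit]
    exact mul_le_mul_of_nonneg_right hchoose (by positivity)
  have h3 := h1.trans (mul_le_mul_of_nonneg_left h2 (by positivity))
  refine le_of_mul_le_mul_left (h3.trans_eq ?_) hfac
  ring

end Paley

end SimplexCochain

theorem theoremp (k : ℕ) (hk : 1 ≤ k) :
    ∃ C : ℝ, ∀ (p : ℕ) [Fact p.Prime], 2 < p → k < p →
      (1 / 2 : ℝ) * (p.choose (k + 1) : ℝ) * (1 - C * (p : ℝ) ^ (-((2 : ℝ) ^ (-(k : ℝ))))) ≤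
        (SimplexCochain.cosystolicNorm (SimplexCochain.paley p k) : ℝ) := by
  -- The multilinear estimate starts at two variables, that is, at `k = 1`.
  obtain ⟨k, rfl⟩ : ∃ l, k = l + 1 := ⟨k - 1, by omega⟩
  obtain ⟨C, hC⟩ := SimplexCochain.exists_sum_sign_le k
  refine ⟨C, fun p _ hp hkp => ?_⟩
  obtain ⟨ψ, hψ⟩ := ciInf_mem fun ψ : SimplexCochain.Cochain (ZMod p) (k + 1) =>
    SimplexCochain.norm (SimplexCochain.paley p (k + 1) + SimplexCochain.coboundary ψ)
  have h := hC p hp.ne' hkp ψ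
  rw [SimplexCochain.cosystolicNorm, ← hψ]
  simp only [SimplexCochain.norm_eq_sum_sign, ZMod.card]
  push_cast
  linarith
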